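/- Let $\mathcal X\subset\mathbb R$ be a finite set, let $\sigma_A,\sigma_E\ge 0$, $0<\sigma_B<1$ and $\alpha_1<\alpha_2$. Consider the channel $$Y_0=X_0+W_0+U_0,\qquad Y_n=X_n+A_nX_{n-1}+B_n(Y_{n-1}-E_{n-1})+W_n+U_n\quad(n\ge 1),$$ where the input $\{X_n\}_{n\ge0}$ takes values in $\mathcal X$; $\{A_n\}$, $\{B_n\}$, $\{E_n\}$, $\{W_n\}$ are i.i.d. Gaussian processes with mean $0$ and variances $\sigma_A^2,\sigma_B^2,\sigma_E^2,1$, respectively; $\{U_n\}$ is i.i.d. uniform on $(\alpha_1,\alpha_2)$; and the six processes $\{A_n\},\{B_n\},\{E_n\},\{W_n\},\{U_n\},\{X_n\}$ are mutually independent. Let $P$ be the underlying probability measure, let $P_Y$ be the law of $\{Y_n\}$ on $\mathbb R^{\mathbb N}$ and $P_{XY}$ the law of $(\{X_n\},\{Y_n\})$ on $\mathcal X^{\mathbb N}\times\mathbb R^{\mathbb N}$, and let $T$ denote the left shift on either sequence space. A probability measure $\mu$ is asymptotically mean stationary if there is a probability measure $\bar\mu$ (its stationary mean) with $\bar\mu(A)=\lim_{n\to\infty}\frac1n\sum_{i=1}^n\mu(T^{-i}A)$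 for every measurable $A$, and it is ergodic if $\mu(A)\in\{0,1\}$ for every measurable $A$ with $T^{-1}A=A$. There is a constant $C$, depending only on $\mathcal X,\sigma_A,\sigma_B,\sigma_E,\alpha_1,\alpha_2$, such that whenever the input process $\{X_n\}$ is stationary and ergodic: 1. $P_Y$ and $P_{XY}$ are asymptotically mean stationary; denote their stationary means by $\bar P_Y$ and $\bar P_{XY}$. 2. $P_Y$ and $P_{XY}$ are ergodic. 3. The one-dimensional marginals converge exponentially fast: for every $k\ge0$ and all Borel sets $D\subset\mathbb R$ and $D'\subset\mathcal X\times\mathbb R$, $$\bigl|P(Y_k\in D)-\bar P_Y(\{y: y_0\in D\})\bigr|\le C\,\sigma_B^{2k},\qquad \bigl|P((X_k,Y_k)\in D')-\bar P_{XY}(\{(x,y): (x_0,y_0)\in D'\})\bigr|\le C\,\sigma_B^{2k}.$$ -/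

import Mathlib

open MeasureTheory ProbabilityTheory Filter Topology
open scoped NNReal

noncomputable section

/-- The left shift on one-sided sequences. -/
def leftShift {β : Type*} (x : ℕ → β) : ℕ → β := fun n => x (n + 1)

/-- The left shift on pairs of one-sided sequences. -/
def leftShiftPair {β γ : Type*} (z : (ℕ → β) × (ℕ → γ)) : (ℕ → β) × (ℕ → γ) :=
  (leftShift z.1, leftShift z.2)

/-- `ν` is the stationary mean of `μ` under `T`: a probability measure such that
`ν(A) = lim (1/n) ∑_{i=1}^n μ(T^{-i} A)` for every measurable `A`. -/
def IsStationaryMean {S : Type*} [MeasurableSpace S] (T : S → S) (μ ν : Measure S) : Prop :=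
  IsProbabilityMeasure ν ∧
    ∀ A : Set S, MeasurableSet A →
      Tendsto (fun n : ℕ => (1 / (n : ℝ)) * ∑ i ∈ Finset.Icc 1 n, μ.real (T^[i] ⁻¹' A))
        atTop (𝓝 (ν.real A))

/-- `μ` is asymptotically mean stationary under `T`. -/
def IsAsymptoticallyMeanStationary {S : Type*} [MeasurableSpace S] (T : S → S)
    (μ : Measure S) : Prop :=
  ∃ ν : Measure S, IsStationaryMean T μ ν

/-- The law of a one-sided process on its sequence space. -/
def processLaw {Ω β : Type*} [MeasurableSpace Ω] [MeasurableSpace β] (P : Measure Ω)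
    (Z : ℕ → Ω → β) : Measure (ℕ → β) :=
  P.map (fun ω n => Z n ω)

/-- The joint law of two one-sided processes on the product of their sequence spaces. -/
def jointProcessLaw {Ω β γ : Type*} [MeasurableSpace Ω] [MeasurableSpace β] [MeasurableSpace γ]
    (P : Measure Ω) (X : ℕ → Ω → β) (Y : ℕ → Ω → γ) : Measure ((ℕ → β) × (ℕ → γ)) :=
  P.map (fun ω => ((fun n => X n ω), (fun n => Y n ω)))

/-- The flash memory channel with input `X` over the finite alphabet `𝒳 ⊆ ℝ`, noises
`A, B, E, W, U` and output `Y`, all defined on the probability space `(Ω, P)`. -/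
structure IsFlashChannel (𝒳 : Finset ℝ) (σA σB σE : ℝ≥0) (α₁ α₂ : ℝ)
    {Ω : Type*} [MeasurableSpace Ω] (P : Measure Ω)
    (X : ℕ → Ω → 𝒳) (A B E W U Y : ℕ → Ω → ℝ) : Prop where
  measurable_X : ∀ n, Measurable (X n)
  measurable_A : ∀ n, Measurable (A n)
  measurable_B : ∀ n, Measurable (B n)
  measurable_E : ∀ n, Measurable (E n)
  measurable_W : ∀ n, Measurable (W n)
  measurable_U : ∀ n, Measurable (U n)
  law_A : ∀ n, P.map (A n) = gaussianReal 0 (σA ^ 2)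
  law_B : ∀ n, P.map (B n) = gaussianReal 0 (σB ^ 2)
  law_E : ∀ n, P.map (E n) = gaussianReal 0 (σE ^ 2)
  law_W : ∀ n, P.map (W n) = gaussianReal 0 1
  law_U : ∀ n, pdf.IsUniform (U n) (Set.Ioo α₁ α₂) P
  indep_A : iIndepFun A P
  indep_B : iIndepFun B P
  indep_E : iIndepFun E P
  indep_W : iIndepFun W P
  indep_U : iIndepFun U P
  /-- The six processes are mutually independent. -/
  indep_processes : iIndepFun
    (![fun ω n => A n ω, fun ω n => B n ω, fun ω n => E n ω, fun ω n => W n ω,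
      fun ω n => U n ω, fun ω n => (X n ω : ℝ)] : Fin 6 → Ω → (ℕ → ℝ)) P
  output_zero : ∀ ω, Y 0 ω = X 0 ω + W 0 ω + U 0 ω
  output_succ : ∀ n ω, Y (n + 1) ω =
    X (n + 1) ω + A (n + 1) ω * X n ω + B (n + 1) ω * (Y n ω - E n ω)
      + W (n + 1) ω + U (n + 1) ω

end

/-!
The outputs form an affine recursion in the random environment given by the input. After a shift of
the time index of `E`, the noise vectors `(B, W, A, E, U)` driving successive steps are i.i.d. and
independent of the input and the initial output (`IsFlashChannel.jointProcessLaw_eq`), so given the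
input the output is a Markov chain with transition operator `channelOp`.

**The rate.** Let `v = σB ^ 2 = 𝔼 B ^ 2`. The Gaussian noise `W` smooths every function with values
in `[-1, 1]` into one whose second symmetric differences `f (t + d) + f (t - d) - 2 * f t` are at
most `4 * d ^ 2` (`abs_second_difference_gaussian_smoothing_le`). Each further step of the chain
replaces a bound `L * d ^ 2` by `L * v * d ^ 2` (`SecondDiffLE.integral_step`). Finally, as `B` is
symmetric, the influence of the previous output `y` on the expectation of `f` after a step is
itself half a second difference of `f`, integrated (`abs_integral_step_sub_le`). Hence the chain
forgets `y` up to an error `O(v ^ i * (1 + y ^ 2))` after `i` steps, uniformly over all events that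
concern the future (`exists_abs_iterate_channelOp_sub_le`). A coupling of two copies of the chain
that uses the same noise would only give the rate `(𝔼 |B|) ^ i`, which is worse when `σB` is small.

**Asymptotic mean stationarity.** The second moments of the outputs stay bounded, because the
conditional second moment of an output given the previous output `y` is at most `c + v * y ^ 2`
with `v < 1`. As the input is stationary, the laws of the processes seen from times `i` and `j ≥ i`
therefore differ by `O(v ^ i)` on every event (`abs_measureReal_preimage_iterate_sub_le`). A
uniformly Cauchy sequence of laws has a setwise limit that is a measure, which is the stationary
mean (`isAsymptoticallyMeanStationary_of_abs_sub_le`), and the same estimate is the claimed speed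
of convergence.

**Ergodicity.** By forgetting, the conditional probability of an invariant event `A` given the
input and the initial output is an invariant function of the input alone, hence almost surely a
constant `c`. By the Markov property `A` is then independent of all events about finitely many
coordinates (`eventProb_inter_cylinder`), hence of itself, and `c` is `0` or `1`
(`preErgodic_map_ioPath`).
-/

/-! ### Smoothing by a standard Gaussian -/

/-- Translation of the standard Gaussian by `b` is integration against the density
`exp (b * w - b ^ 2 / 2)`. -/
theorem integral_gaussianReal_add (f : ℝ → ℝ) (t b : ℝ) :
    ∫ w, f (w + (t + b)) ∂(gaussianReal 0 1)
      = ∫ w, Real.exp (b * w - b ^ 2 / 2) * f (w + t) ∂(gaussianReal 0 1) := by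
  have h : ∫ w, f (w + (t + b)) ∂(gaussianReal 0 1) = ∫ w, f (w + t) ∂(gaussianReal b 1) := by
    have hmap := gaussianReal_map_add_const (μ := 0) (v := 1) b
    rw [zero_add] at hmap
    rw [← hmap, (measurableEmbedding_addRight b).integral_map]
    refine integral_congr_ae (ae_of_all _ fun w => ?_)
    show f (w + (t + b)) = f (w + b + t)
    congr 1; ring
  rw [h, integral_gaussianReal_eq_integral_smul one_ne_zero,
    integral_gaussianReal_eq_integral_smul one_ne_zero]
  refine integral_congr_ae (ae_of_all _ fun w => ?_)
  simp only [gaussianPDFReal, smul_eq_mul, ← mul_assoc, NNReal.coe_one, sub_zero, mul_one]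
  congr 1
  rw [mul_assoc, ← Real.exp_add]
  ring_nf

theorem integrable_gaussian_exp (a c : ℝ) :
    Integrable (fun w => Real.exp (a * w - c)) (gaussianReal 0 1) := by
  simp_rw [Real.exp_sub]
  exact (integrable_exp_mul_gaussianReal a).div_const _

theorem integral_gaussian_exp (a c : ℝ) :
    ∫ w, Real.exp (a * w - c) ∂(gaussianReal 0 1) = Real.exp (a ^ 2 / 2 - c) := by
  have h := congrFun (mgf_fun_id_gaussianReal (μ := 0) (v := 1)) a
  simp only [mgf] at h
  simp_rw [Real.exp_sub, integral_div, h]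
  norm_num

/-- The second difference of the Gaussian density has `L¹` norm of order `b ^ 2`; the bound follows
from the explicit `L²` norm of its quotient by the density. -/
theorem integral_abs_gaussian_second_difference_le {b : ℝ} (hb0 : b ≠ 0) (hb : |b| ≤ 1) :
    ∫ w, |Real.exp (b * w - b ^ 2 / 2) + Real.exp (-b * w - b ^ 2 / 2) - 2| ∂(gaussianReal 0 1)
      ≤ 4 * b ^ 2 := by
  set q : ℝ → ℝ := fun w => Real.exp (b * w - b ^ 2 / 2) + Real.exp (-b * w - b ^ 2 / 2) - 2
  have hq : ∀ w, (q w) ^ 2 = Real.exp (2 * b * w - b ^ 2) + Real.exp (-2 * b * w - b ^ 2)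
      - 4 * Real.exp (b * w - b ^ 2 / 2) - 4 * Real.exp (-b * w - b ^ 2 / 2)
      + (4 + 2 * Real.exp (-b ^ 2)) := by
    intro w
    have e1 : Real.exp (2 * b * w - b ^ 2) = Real.exp (b * w - b ^ 2 / 2) ^ 2 := by
      rw [← Real.exp_nat_mul]; congr 1; push_cast; ring
    have e2 : Real.exp (-2 * b * w - b ^ 2) = Real.exp (-b * w - b ^ 2 / 2) ^ 2 := by
      rw [← Real.exp_nat_mul]; congr 1; push_cast; ring
    have e3 : Real.exp (-b ^ 2)
        = Real.exp (b * w - b ^ 2 / 2) * Real.exp (-b * w - b ^ 2 / 2) := by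
      rw [← Real.exp_add]; congr 1; ring
    rw [e1, e2, e3]; simp only [q]; ring
  have i1 := integrable_gaussian_exp (2 * b) (b ^ 2)
  have i2 := integrable_gaussian_exp (-2 * b) (b ^ 2)
  have i3 := (integrable_gaussian_exp b (b ^ 2 / 2)).const_mul 4
  have i4 := (integrable_gaussian_exp (-b) (b ^ 2 / 2)).const_mul 4
  have iq2 : Integrable (fun w => (q w) ^ 2) (gaussianReal 0 1) := by
    simp_rw [hq]
    exact (((i1.add i2).sub i3).sub i4).add (integrable_const _)
  have hint : ∫ w, (q w) ^ 2 ∂(gaussianReal 0 1)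
      = 2 * Real.exp (b ^ 2) + 2 * Real.exp (-b ^ 2) - 4 := by
    simp_rw [hq]
    have i123 : Integrable (fun w => Real.exp (2 * b * w - b ^ 2) + Real.exp (-2 * b * w - b ^ 2)
        - 4 * Real.exp (b * w - b ^ 2 / 2)) (gaussianReal 0 1) := (i1.add i2).sub i3
    have i1234 : Integrable (fun w => Real.exp (2 * b * w - b ^ 2) + Real.exp (-2 * b * w - b ^ 2)
        - 4 * Real.exp (b * w - b ^ 2 / 2) - 4 * Real.exp (-b * w - b ^ 2 / 2))
        (gaussianReal 0 1) := i123.sub i4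
    rw [integral_add i1234 (integrable_const _),
      integral_sub i123 i4, integral_sub (i1.fun_add i2) i3, integral_add i1 i2,
      integral_const_mul, integral_const_mul, integral_gaussian_exp, integral_gaussian_exp,
      integral_gaussian_exp, integral_gaussian_exp]
    have e1 : (2 * b) ^ 2 / 2 - b ^ 2 = b ^ 2 := by ring
    have e2 : (-2 * b) ^ 2 / 2 - b ^ 2 = b ^ 2 := by ring
    have e3 : b ^ 2 / 2 - b ^ 2 / 2 = 0 := by ring
    have e4 : (-b) ^ 2 / 2 - b ^ 2 / 2 = 0 := by ring
    rw [e1, e2, e3, e4]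
    simp
    ring
  have hb2 : 0 < b ^ 2 := by positivity
  have hb21 : b ^ 2 ≤ 1 := by rw [← sq_abs]; exact pow_le_one₀ (abs_nonneg b) hb
  have hcosh : 2 * Real.exp (b ^ 2) + 2 * Real.exp (-b ^ 2) - 4 ≤ 4 * (b ^ 2) ^ 2 := by
    have h1 := Real.cosh_le_exp_half_sq (b ^ 2)
    rw [Real.cosh_eq] at h1
    have hx : |(b ^ 2) ^ 2 / 2| ≤ 1 := by rw [abs_of_nonneg (by positivity)]; nlinarith
    have h2 := Real.abs_exp_sub_one_le hx
    rw [abs_of_nonneg (a := (b ^ 2) ^ 2 / 2) (by positivity)] at h2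
    have := (abs_le.1 h2).2
    linarith
  have iq : Integrable q (gaussianReal 0 1) :=
    ((integrable_gaussian_exp b (b ^ 2 / 2)).add
      (integrable_gaussian_exp (-b) (b ^ 2 / 2))).sub (integrable_const _)
  calc ∫ w, |q w| ∂(gaussianReal 0 1)
      ≤ ∫ w, ((1 / (2 * b ^ 2)) * (q w) ^ 2 + b ^ 2 / 2) ∂(gaussianReal 0 1) := by
        refine integral_mono iq.abs ((iq2.const_mul _).add (integrable_const _)) fun w => ?_
        -- the weights in `2 * |q w| * b ^ 2 ≤ q w ^ 2 + b ^ 4` balance the two terms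
        have h := two_mul_le_add_sq |q w| (b ^ 2)
        rw [sq_abs] at h
        have e : (1 / (2 * b ^ 2)) * (q w) ^ 2 + b ^ 2 / 2
            = ((q w) ^ 2 + (b ^ 2) ^ 2) / (2 * b ^ 2) := by field_simp
        show |q w| ≤ _
        rw [e, le_div_iff₀ (by positivity)]
        linarith
    _ = (1 / (2 * b ^ 2)) * (2 * Real.exp (b ^ 2) + 2 * Real.exp (-b ^ 2) - 4) + b ^ 2 / 2 := by
        rw [integral_add (iq2.const_mul _) (integrable_const _), integral_const_mul, hint]; simp
    _ ≤ (1 / (2 * b ^ 2)) * (4 * (b ^ 2) ^ 2) + b ^ 2 / 2 := by gcongr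
    _ ≤ 4 * b ^ 2 := by
        have : (1 / (2 * b ^ 2)) * (4 * (b ^ 2) ^ 2) = 2 * b ^ 2 := by field_simp; ring
        rw [this]; linarith

/-- Convolution with a standard Gaussian turns a bounded measurable function into one whose second
differences are quadratically small. -/
theorem abs_second_difference_gaussian_smoothing_le {f : ℝ → ℝ} (hf : Measurable f)
    (hf1 : ∀ t, |f t| ≤ 1) (t b : ℝ) :
    |∫ w, f (w + (t + b)) ∂(gaussianReal 0 1) + ∫ w, f (w + (t - b)) ∂(gaussianReal 0 1)
      - 2 * ∫ w, f (w + t) ∂(gaussianReal 0 1)| ≤ 4 * b ^ 2 := by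
  have hle : ∀ s, |∫ w, f (w + s) ∂(gaussianReal 0 1)| ≤ 1 := by
    intro s
    have := norm_integral_le_of_norm_le_const (μ := gaussianReal 0 1) (C := 1)
      (f := fun w => f (w + s)) (ae_of_all _ fun w => hf1 _)
    simpa using this
  rcases le_or_gt |b| 1 with hb | hb
  · rcases eq_or_ne b 0 with rfl | hb0
    · simp only [add_zero, sub_zero]
      rw [← two_mul, sub_self]; simp
    have hm : Measurable fun w => f (w + t) := hf.comp (by fun_prop)
    have ift : Integrable (fun w => f (w + t)) (gaussianReal 0 1) :=
      Integrable.of_bound hm.aestronglyMeasurable 1 (ae_of_all _ fun w => hf1 _)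
    have im : ∀ a c : ℝ, Integrable (fun w => Real.exp (a * w - c) * f (w + t))
        (gaussianReal 0 1) := fun a c =>
      (integrable_gaussian_exp a c).mul_bdd (c := 1) hm.aestronglyMeasurable
        (ae_of_all _ fun w => hf1 _)
    have h1 := integral_gaussianReal_add f t b
    have h2 := integral_gaussianReal_add f t (-b)
    rw [← sub_eq_add_neg, neg_sq] at h2
    rw [h1, h2, ← integral_add (im _ _) (im _ _), ← integral_const_mul,
      ← integral_sub ((im _ _).fun_add (im _ _)) (ift.const_mul 2)]
    refine (abs_integral_le_integral_abs).trans (le_trans ?_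
      (integral_abs_gaussian_second_difference_le hb0 hb))
    refine integral_mono (((im _ _).add (im _ _)).sub (ift.const_mul 2)).abs
      (((integrable_gaussian_exp b (b ^ 2 / 2)).add
        (integrable_gaussian_exp (-b) (b ^ 2 / 2))).sub (integrable_const _)).abs fun w => ?_
    show |_| ≤ |_|
    have e : Real.exp (b * w - b ^ 2 / 2) * f (w + t) + Real.exp (-b * w - b ^ 2 / 2) * f (w + t)
        - 2 * f (w + t)
      = (Real.exp (b * w - b ^ 2 / 2) + Real.exp (-b * w - b ^ 2 / 2) - 2) * f (w + t) := by ring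
    rw [e, abs_mul]
    exact mul_le_of_le_one_right (abs_nonneg _) (hf1 _)
  · have h1 := abs_le.1 (hle (t + b))
    have h2 := abs_le.1 (hle (t - b))
    have h3 := abs_le.1 (hle t)
    have hb2 : 1 ≤ b ^ 2 := by rw [← sq_abs]; nlinarith
    rw [abs_le]
    constructor <;> linarith [h1.1, h1.2, h2.1, h2.2, h3.1, h3.2]

/-! ### One step of the channel -/

/-- One step of the channel: the output produced from the previous output `y`, the previous and
current inputs `x₀`, `x₁`, and the noise `r = (B, W, A, E, U)`. -/
def channelStep (x₀ x₁ : ℝ) (r : Fin 5 → ℝ) (y : ℝ) : ℝ :=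
  x₁ + r 2 * x₀ + r 0 * (y - r 3) + r 1 + r 4

/-- The part of `channelStep` that does not involve the previous output. -/
def channelFresh (x₀ x₁ : ℝ) (r : Fin 5 → ℝ) : ℝ :=
  x₁ + r 2 * x₀ + r 1 + r 4

/-- The properties of the noise law `μ = (law of B, W, A, E, U)` on which the convergence rests;
`v` is the second moment of the feedback coefficient `B`. -/
structure IsChannelNoise (μ : Fin 5 → Measure ℝ) (v : ℝ) : Prop where
  memLp : ∀ i, MemLp id 2 (μ i)
  symm : (μ 0).map (fun b => -b) = μ 0
  second_moment : ∫ b, b ^ 2 ∂(μ 0) = v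
  gaussian : μ 1 = gaussianReal 0 1
  mean_zero : ∫ e, e ∂(μ 3) = 0

/-- The second symmetric differences of `f` are at most `L * d ^ 2`, a bound `L` on the second
derivative that needs no differentiability. -/
def SecondDiffLE (f : ℝ → ℝ) (L : ℝ) : Prop :=
  ∀ t d, |f (t + d) + f (t - d) - 2 * f t| ≤ L * d ^ 2

section

variable {μ : Fin 5 → Measure ℝ} [∀ i, IsProbabilityMeasure (μ i)] {v : ℝ}

@[fun_prop]
theorem measurable_channelStep (x₀ x₁ y : ℝ) : Measurable fun r => channelStep x₀ x₁ r y := by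
  unfold channelStep; fun_prop

theorem measurable_channelFresh (x₀ x₁ : ℝ) : Measurable (channelFresh x₀ x₁) := by
  unfold channelFresh; fun_prop

theorem channelStep_eq (x₀ x₁ : ℝ) (r : Fin 5 → ℝ) (y : ℝ) :
    channelStep x₀ x₁ r y = channelFresh x₀ x₁ r + r 0 * (y - r 3) := by
  unfold channelStep channelFresh; ring

theorem integral_eval_pi (i : Fin 5) {g : ℝ → ℝ} (hg : Measurable g) :
    ∫ r, g (r i) ∂(Measure.pi μ) = ∫ b, g b ∂(μ i) := by
  have h := (measurePreserving_eval μ i).map_eq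
  conv_rhs => rw [← h]
  rw [integral_map (measurable_pi_apply i).aemeasurable hg.aestronglyMeasurable]

theorem memLp_eval (h : IsChannelNoise μ v) (i : Fin 5) :
    MemLp (fun r : Fin 5 → ℝ => r i) 2 (Measure.pi μ) :=
  (h.memLp i).comp_measurePreserving (measurePreserving_eval μ i)

theorem integral_feedback_sq (h : IsChannelNoise μ v) :
    ∫ r : Fin 5 → ℝ, (r 0) ^ 2 ∂(Measure.pi μ) = v := by
  rw [integral_eval_pi 0 (g := fun b => b ^ 2) (by fun_prop), h.second_moment]

theorem indepFun_feedback (y : ℝ) :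
    IndepFun (fun r : Fin 5 → ℝ => (r 0) ^ 2) (fun r => (y - r 3) ^ 2) (Measure.pi μ) := by
  have hi : iIndepFun (fun (i : Fin 5) (r : Fin 5 → ℝ) => r i) (Measure.pi μ) :=
    iIndepFun_pi (X := fun _ x => x) (fun i => aemeasurable_id)
  have := hi.indepFun (show (0 : Fin 5) ≠ 3 by decide)
  exact this.comp (φ := fun b => b ^ 2) (ψ := fun e => (y - e) ^ 2) (by fun_prop) (by fun_prop)

theorem integral_sub_error_sq (h : IsChannelNoise μ v) (y : ℝ) :
    ∫ r : Fin 5 → ℝ, (y - r 3) ^ 2 ∂(Measure.pi μ) = y ^ 2 + ∫ e, e ^ 2 ∂(μ 3) := by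
  rw [integral_eval_pi 3 (g := fun e => (y - e) ^ 2) (by fun_prop)]
  have i1 : Integrable (fun e : ℝ => e) (μ 3) := (h.memLp 3).integrable (by norm_num)
  have i2 : Integrable (fun e : ℝ => e ^ 2) (μ 3) := (h.memLp 3).integrable_sq
  have e : ∀ e : ℝ, (y - e) ^ 2 = y ^ 2 - 2 * y * e + e ^ 2 := fun e => by ring
  simp_rw [e]
  have i12 : Integrable (fun e : ℝ => y ^ 2 - 2 * y * e) (μ 3) :=
    (integrable_const _).sub (i1.const_mul _)
  rw [integral_add i12 i2, integral_sub (integrable_const _) (i1.const_mul _),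
    integral_const_mul, h.mean_zero]
  simp

theorem integrable_feedback_mul (h : IsChannelNoise μ v) (y : ℝ) :
    Integrable (fun r : Fin 5 → ℝ => (r 0) ^ 2 * (y - r 3) ^ 2) (Measure.pi μ) :=
  (indepFun_feedback y).integrable_mul (memLp_eval h 0).integrable_sq
    (((memLp_const y).sub (memLp_eval h 3)).integrable_sq)

theorem integral_feedback_mul (h : IsChannelNoise μ v) (y : ℝ) :
    ∫ r : Fin 5 → ℝ, (r 0) ^ 2 * (y - r 3) ^ 2 ∂(Measure.pi μ)
      = v * (y ^ 2 + ∫ e, e ^ 2 ∂(μ 3)) := by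
  rw [← integral_feedback_sq h, ← integral_sub_error_sq h y]
  exact (indepFun_feedback y).integral_mul_eq_mul_integral
    (Measurable.aestronglyMeasurable (by fun_prop)) (Measurable.aestronglyMeasurable (by fun_prop))

/-- Reflection of the feedback coefficient. -/
def flipFeedback (r : Fin 5 → ℝ) : Fin 5 → ℝ := fun i => if i = 0 then -r i else r i

theorem measurable_flipFeedback : Measurable flipFeedback := by
  refine measurable_pi_lambda _ fun i => ?_
  unfold flipFeedback
  split_ifs <;> fun_prop

theorem map_flipFeedback (h : IsChannelNoise μ v) :
    (Measure.pi μ).map flipFeedback = Measure.pi μ := by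
  have hm : ∀ i, (μ i).map (fun b => if i = 0 then -b else b) = μ i := by
    intro i
    by_cases hi : i = 0
    · subst hi; simpa using h.symm
    · simp [hi]
  have hs : ∀ i, SigmaFinite ((μ i).map (fun b => if i = 0 then -b else b)) := by
    intro i; rw [hm]; infer_instance
  have := Measure.pi_map_pi (μ := μ) (f := fun i b => if i = 0 then -b else b) (fun i => by
    by_cases hi : i = 0 <;> simp [hi] <;> fun_prop)
  simp_rw [hm] at this
  exact this

theorem integral_flipFeedback (h : IsChannelNoise μ v) {g : (Fin 5 → ℝ) → ℝ}
    (hg : Measurable g) :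
    ∫ r, g (flipFeedback r) ∂(Measure.pi μ) = ∫ r, g r ∂(Measure.pi μ) := by
  conv_rhs => rw [← map_flipFeedback h]
  rw [integral_map measurable_flipFeedback.aemeasurable hg.aestronglyMeasurable]

theorem channelStep_flipFeedback (x₀ x₁ : ℝ) (r : Fin 5 → ℝ) (y : ℝ) :
    channelStep x₀ x₁ (flipFeedback r) y = channelFresh x₀ x₁ r - r 0 * (y - r 3) := by
  simp [channelStep, channelFresh, flipFeedback]; ring

theorem integrable_comp_of_abs_le_one {α : Type*} [MeasurableSpace α] {ρ : Measure α}
    [IsProbabilityMeasure ρ] {f : α → ℝ} (hf : Measurable f)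
    (hf1 : ∀ t, |f t| ≤ 1) : Integrable f ρ :=
  Integrable.of_bound hf.aestronglyMeasurable 1 (ae_of_all _ hf1)

/-- A channel step multiplies second differences by the second moment of the feedback. Here
`G` is the part of the next output that does not involve the present output `y`; it may or may not
contain the smoothing noise. -/
theorem SecondDiffLE.integral_step (h : IsChannelNoise μ v) {f : ℝ → ℝ} {L : ℝ}
    (hf : Measurable f) (hf1 : ∀ t, |f t| ≤ 1) (hL : SecondDiffLE f L)
    {G : (Fin 5 → ℝ) → ℝ} (hG : Measurable G) :
    SecondDiffLE (fun y => ∫ r, f (G r + r 0 * (y - r 3)) ∂(Measure.pi μ)) (L * v) := by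
  intro t d
  have hi : ∀ y, Integrable (fun r : Fin 5 → ℝ => f (G r + r 0 * (y - r 3))) (Measure.pi μ) :=
    fun y => integrable_comp_of_abs_le_one (hf.comp (by fun_prop)) fun _ => hf1 _
  have hi2 : Integrable (fun r : Fin 5 → ℝ => L * d ^ 2 * (r 0) ^ 2) (Measure.pi μ) :=
    (memLp_eval h 0).integrable_sq.const_mul _
  have hv : L * v * d ^ 2 = ∫ r : Fin 5 → ℝ, L * d ^ 2 * (r 0) ^ 2 ∂(Measure.pi μ) := by
    rw [integral_const_mul, integral_feedback_sq h]; ring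
  rw [hv]
  simp only
  rw [← integral_add (hi _) (hi _), ← integral_const_mul,
    ← integral_sub ((hi _).fun_add (hi _)) ((hi _).const_mul 2)]
  refine abs_integral_le_integral_abs.trans
    (integral_mono (((hi _).add (hi _)).sub ((hi _).const_mul 2)).abs hi2 fun r => ?_)
  have := hL (G r + r 0 * (t - r 3)) (r 0 * d)
  have e1 : G r + r 0 * (t + d - r 3) = G r + r 0 * (t - r 3) + r 0 * d := by ring
  have e2 : G r + r 0 * (t - d - r 3) = G r + r 0 * (t - r 3) - r 0 * d := by ring
  simp only [e1, e2]
  calc _ ≤ _ := this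
    _ = _ := by ring

/-- Since the feedback coefficient is symmetric, a channel step forgets the previous output up to
an error that is of second order. -/
theorem abs_integral_step_sub_le (h : IsChannelNoise μ v) {f : ℝ → ℝ} {L : ℝ}
    (hf : Measurable f) (hf1 : ∀ t, |f t| ≤ 1) (hL : SecondDiffLE f L) (x₀ x₁ y : ℝ) :
    |∫ r, f (channelStep x₀ x₁ r y) ∂(Measure.pi μ) - ∫ r, f (channelFresh x₀ x₁ r) ∂(Measure.pi μ)|
      ≤ L * v * (y ^ 2 + ∫ e, e ^ 2 ∂(μ 3)) / 2 := by
  have hG := measurable_channelFresh x₀ x₁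
  have i1 : Integrable (fun r : Fin 5 → ℝ => f (channelFresh x₀ x₁ r + r 0 * (y - r 3)))
      (Measure.pi μ) := integrable_comp_of_abs_le_one (hf.comp (by fun_prop)) fun _ => hf1 _
  have i2 : Integrable (fun r : Fin 5 → ℝ => f (channelFresh x₀ x₁ r - r 0 * (y - r 3)))
      (Measure.pi μ) := integrable_comp_of_abs_le_one (hf.comp (by fun_prop)) fun _ => hf1 _
  have i3 : Integrable (fun r : Fin 5 → ℝ => f (channelFresh x₀ x₁ r))
      (Measure.pi μ) := integrable_comp_of_abs_le_one (hf.comp (by fun_prop)) fun _ => hf1 _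
  have hfl : ∫ r, f (channelFresh x₀ x₁ r - r 0 * (y - r 3)) ∂(Measure.pi μ)
      = ∫ r, f (channelFresh x₀ x₁ r + r 0 * (y - r 3)) ∂(Measure.pi μ) := by
    have := integral_flipFeedback h (g := fun r => f (channelStep x₀ x₁ r y))
      (hf.comp (by fun_prop))
    simp only [channelStep_flipFeedback] at this
    simpa only [channelStep_eq] using this
  simp_rw [channelStep_eq]
  -- by reflection, twice the left-hand side is the integral of a second difference
  have key : |∫ r, (f (channelFresh x₀ x₁ r + r 0 * (y - r 3))
      + f (channelFresh x₀ x₁ r - r 0 * (y - r 3)) - 2 * f (channelFresh x₀ x₁ r)) ∂(Measure.pi μ)|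
      ≤ L * v * (y ^ 2 + ∫ e, e ^ 2 ∂(μ 3)) := by
    have e : L * v * (y ^ 2 + ∫ e, e ^ 2 ∂(μ 3))
        = ∫ r : Fin 5 → ℝ, L * ((r 0) ^ 2 * (y - r 3) ^ 2) ∂(Measure.pi μ) := by
      rw [integral_const_mul, integral_feedback_mul h]; ring
    rw [e]
    refine abs_integral_le_integral_abs.trans
      (integral_mono ((i1.add i2).sub (i3.const_mul 2)).abs
        ((integrable_feedback_mul h y).const_mul L) fun r => ?_)
    calc _ ≤ _ := hL (channelFresh x₀ x₁ r) (r 0 * (y - r 3))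
      _ = _ := by ring
  rw [integral_sub (i1.fun_add i2) (i3.const_mul 2), integral_add i1 i2, hfl, integral_const_mul,
    ← two_mul, ← mul_sub, abs_mul, abs_two] at key
  linarith

/-- Integration of a function of the channel noise in which the additive Gaussian noise appears
only as a translation. -/
theorem integral_gaussian_coordinate (h : IsChannelNoise μ v) {f : ℝ → ℝ} (hf : Measurable f)
    (hf1 : ∀ t, |f t| ≤ 1) {t : (Fin 5 → ℝ) → ℝ} (ht : Measurable t)
    (ht1 : ∀ r w, t (Function.update r 1 w) = t r) :
    ∫ r, f (r 1 + t r) ∂(Measure.pi μ)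
      = ∫ r, (∫ w, f (w + t r) ∂(gaussianReal 0 1)) ∂(Measure.pi μ) := by
  have hmp := (measurePreserving_piFinSuccAbove μ 1).symm
  have ht2 : ∀ w (r : Fin 4 → ℝ), t (Fin.insertNth (α := fun _ => ℝ) (1 : Fin 5) w r)
      = t (Fin.insertNth (α := fun _ => ℝ) (1 : Fin 5) 0 r) := by
    intro w r
    rw [← ht1 _ 0, Fin.update_insertNth]
  have hs : Measurable fun s => ∫ w, f (w + s) ∂(gaussianReal 0 1) := by
    have : StronglyMeasurable fun p : ℝ × ℝ => f (p.2 + p.1) :=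
      (hf.comp (by fun_prop)).stronglyMeasurable
    exact (this.integral_prod_right (ν := gaussianReal 0 1)).measurable
  have hs1 : ∀ s, |∫ w, f (w + s) ∂(gaussianReal 0 1)| ≤ 1 := by
    intro s
    have := norm_integral_le_of_norm_le_const (μ := gaussianReal 0 1) (C := 1)
      (f := fun w => f (w + s)) (ae_of_all _ fun w => hf1 _)
    simpa using this
  rw [← hmp.integral_comp', ← hmp.integral_comp', integral_prod_symm, integral_prod_symm]
  · refine integral_congr_ae (ae_of_all _ fun r => ?_)
    have e : ∀ w : ℝ, (MeasurableEquiv.piFinSuccAbove (fun _ => ℝ) (1 : Fin 5)).symm (w, r)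
        = Fin.insertNth (α := fun _ => ℝ) (1 : Fin 5) w r := fun w => rfl
    simp only [e]
    simp_rw [ht2, Fin.insertNth_apply_same]
    simp [h.gaussian]
  · have hm : Measurable fun r : Fin 5 → ℝ => ∫ w, f (w + t r) ∂(gaussianReal 0 1) := hs.comp ht
    exact integrable_comp_of_abs_le_one (hm.comp hmp.measurable) fun _ => hs1 _
  · have hm : Measurable fun r : Fin 5 → ℝ => f (r 1 + t r) := hf.comp (by fun_prop)
    exact integrable_comp_of_abs_le_one (hm.comp hmp.measurable) fun _ => hf1 _

/-- One channel step maps bounded functions to functions with bounded second differences. -/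
theorem secondDiffLE_integral_step (h : IsChannelNoise μ v) {f : ℝ → ℝ} (hf : Measurable f)
    (hf1 : ∀ t, |f t| ≤ 1) (x₀ x₁ : ℝ) :
    SecondDiffLE (fun y => ∫ r, f (channelStep x₀ x₁ r y) ∂(Measure.pi μ)) (4 * v) := by
  set s : ℝ → ℝ := fun t => ∫ w, f (w + t) ∂(gaussianReal 0 1)
  have hs : Measurable s := by
    have : StronglyMeasurable fun p : ℝ × ℝ => f (p.2 + p.1) :=
      (hf.comp (by fun_prop)).stronglyMeasurable
    exact (this.integral_prod_right (ν := gaussianReal 0 1)).measurable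
  have hs1 : ∀ t, |s t| ≤ 1 := by
    intro t
    have := norm_integral_le_of_norm_le_const (μ := gaussianReal 0 1) (C := 1)
      (f := fun w => f (w + t)) (ae_of_all _ fun w => hf1 _)
    simpa using this
  have hL : SecondDiffLE s 4 := fun t d => abs_second_difference_gaussian_smoothing_le hf hf1 t d
  -- once the Gaussian noise is integrated out, the rest is a step without that noise
  have := hL.integral_step h hs hs1 (G := fun r => x₁ + r 2 * x₀ + r 4) (by fun_prop)
  convert this using 2 with y
  rw [← integral_gaussian_coordinate h hf hf1 (t := fun r => x₁ + r 2 * x₀ + r 4 + r 0 * (y - r 3))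
    (by fun_prop) (by intro r w; simp [Function.update])]
  congr 1; ext r; congr 1; unfold channelStep; ring

theorem memLp_channelFresh (h : IsChannelNoise μ v) (x₀ x₁ : ℝ) :
    MemLp (channelFresh x₀ x₁) 2 (Measure.pi μ) := by
  have := (((memLp_const x₁).add ((memLp_eval h 2).const_mul x₀)).add (memLp_eval h 1)).add
    (memLp_eval h 4)
  refine this.ae_eq (ae_of_all _ fun r => ?_)
  simp [channelFresh, mul_comm]

theorem memLp_channelStep (h : IsChannelNoise μ v) (x₀ x₁ y : ℝ) :
    MemLp (fun r => channelStep x₀ x₁ r y) 2 (Measure.pi μ) := by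
  have h2 : MemLp (fun r : Fin 5 → ℝ => r 0 * (y - r 3)) 2 (Measure.pi μ) := by
    rw [memLp_two_iff_integrable_sq (by fun_prop)]
    simpa only [mul_pow] using integrable_feedback_mul h y
  simp only [channelStep_eq]
  exact (memLp_channelFresh h x₀ x₁).add h2

/-- The conditional second moment of the output is affine in the square of the previous output,
with slope `v`. -/
theorem integral_channelStep_sq (h : IsChannelNoise μ v) (x₀ x₁ y : ℝ) :
    ∫ r, (channelStep x₀ x₁ r y) ^ 2 ∂(Measure.pi μ)
      = ∫ r, (channelFresh x₀ x₁ r) ^ 2 ∂(Measure.pi μ) + v * (y ^ 2 + ∫ e, e ^ 2 ∂(μ 3)) := by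
  have hG := measurable_channelFresh x₀ x₁
  have hm : Measurable fun r => (channelStep x₀ x₁ r y) ^ 2 := by fun_prop
  have hfl := integral_flipFeedback h hm
  have i1 := (memLp_channelStep h x₀ x₁ y).integrable_sq
  have i2 : Integrable (fun r => (channelStep x₀ x₁ (flipFeedback r) y) ^ 2) (Measure.pi μ) := by
    have hmp : MeasurePreserving flipFeedback (Measure.pi μ) (Measure.pi μ) :=
      ⟨measurable_flipFeedback, map_flipFeedback h⟩
    exact hmp.integrable_comp_of_integrable i1
  have i3 := (memLp_channelFresh h x₀ x₁).integrable_sq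
  -- averaging over the reflection removes the cross term
  have hsum : ∫ r, (channelStep x₀ x₁ (flipFeedback r) y) ^ 2 ∂(Measure.pi μ)
        + ∫ r, (channelStep x₀ x₁ r y) ^ 2 ∂(Measure.pi μ)
      = 2 * (∫ r, (channelFresh x₀ x₁ r) ^ 2 ∂(Measure.pi μ)
        + v * (y ^ 2 + ∫ e, e ^ 2 ∂(μ 3))) := by
    rw [← integral_feedback_mul h, ← integral_add i2 i1,
      ← integral_add i3 (integrable_feedback_mul h y), ← integral_const_mul]
    refine integral_congr_ae (ae_of_all _ fun r => ?_)
    simp only [channelStep_flipFeedback]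
    simp only [channelStep_eq]
    ring
  rw [hfl] at hsum
  linarith

end

/-! ### The transition operator: forgetting and drift -/

section

variable {𝒳 : Finset ℝ} {μ : Fin 5 → Measure ℝ} {v : ℝ}

theorem measurable_leftShift {β : Type*} [MeasurableSpace β] :
    Measurable (leftShift : (ℕ → β) → ℕ → β) :=
  measurable_pi_lambda _ fun n => measurable_pi_apply (n + 1)

theorem measurable_leftShiftPair {β γ : Type*} [MeasurableSpace β] [MeasurableSpace γ] :
    Measurable (leftShiftPair : (ℕ → β) × (ℕ → γ) → (ℕ → β) × (ℕ → γ)) :=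
  (measurable_leftShift.comp measurable_fst).prodMk (measurable_leftShift.comp measurable_snd)

/-- One step of the chain whose state consists of the input sequence seen from the present time
and the present output. -/
def stateStep (z : (ℕ → 𝒳) × ℝ) (r : Fin 5 → ℝ) : (ℕ → 𝒳) × ℝ :=
  (leftShift z.1, channelStep (z.1 0) (z.1 1) r z.2)

theorem measurable_stateStep :
    Measurable fun p : ((ℕ → 𝒳) × ℝ) × (Fin 5 → ℝ) => stateStep p.1 p.2 := by
  refine (measurable_leftShift.comp (by fun_prop)).prodMk ?_
  unfold channelStep
  fun_prop

/-- The transition operator of the chain `stateStep` driven by noise of law `μ`. -/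
noncomputable def channelOp (μ : Fin 5 → Measure ℝ) (f : (ℕ → 𝒳) × ℝ → ℝ) (z : (ℕ → 𝒳) × ℝ) : ℝ :=
  ∫ r, f (stateStep z r) ∂(Measure.pi μ)

variable [∀ i, IsProbabilityMeasure (μ i)]

theorem measurable_channelOp {f : (ℕ → 𝒳) × ℝ → ℝ} (hf : Measurable f) :
    Measurable (channelOp μ f) := by
  have : StronglyMeasurable fun p : ((ℕ → 𝒳) × ℝ) × (Fin 5 → ℝ) => f (stateStep p.1 p.2) :=
    (hf.comp measurable_stateStep).stronglyMeasurable
  exact (this.integral_prod_right (ν := Measure.pi μ)).measurable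

theorem abs_integral_le_one {α : Type*} [MeasurableSpace α] {ρ : Measure α}
    [IsProbabilityMeasure ρ] {f : α → ℝ} (hf1 : ∀ t, |f t| ≤ 1) : |∫ a, f a ∂ρ| ≤ 1 := by
  have := norm_integral_le_of_norm_le_const (μ := ρ) (C := 1) (f := f) (ae_of_all _ hf1)
  simpa using this

theorem measurable_iterate_channelOp {f : (ℕ → 𝒳) × ℝ → ℝ} (hf : Measurable f) (i : ℕ) :
    Measurable ((channelOp μ)^[i] f) := by
  induction i with
  | zero => exact hf
  | succ i ih => rw [Function.iterate_succ_apply']; exact measurable_channelOp ih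

theorem abs_iterate_channelOp_le {f : (ℕ → 𝒳) × ℝ → ℝ} (hf1 : ∀ z, |f z| ≤ 1) (i : ℕ) :
    ∀ z, |(channelOp μ)^[i] f z| ≤ 1 := by
  induction i with
  | zero => exact hf1
  | succ i ih => intro z; rw [Function.iterate_succ_apply']; exact abs_integral_le_one fun r => ih _

theorem measurable_stateStep_right (z : (ℕ → 𝒳) × ℝ) : Measurable (stateStep z) :=
  measurable_stateStep.comp measurable_prodMk_left

/-- Second differences in the output variable decay at the rate `v ^ i`. -/
theorem secondDiffLE_iterate_channelOp (h : IsChannelNoise μ v) {f : (ℕ → 𝒳) × ℝ → ℝ}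
    (hf : Measurable f) (hf1 : ∀ z, |f z| ≤ 1) (i : ℕ) (x : ℕ → 𝒳) :
    SecondDiffLE (fun y => (channelOp μ)^[i + 1] f (x, y)) (4 * v ^ (i + 1)) := by
  induction i generalizing x with
  | zero =>
    rw [zero_add, pow_one]
    exact secondDiffLE_integral_step h (f := fun y => f (leftShift x, y))
      (hf.comp measurable_prodMk_left) (fun _ => hf1 _) (x 0) (x 1)
  | succ i ih =>
    have := (ih (leftShift x)).integral_step h
      ((measurable_iterate_channelOp hf _).comp measurable_prodMk_left)
      (fun _ => abs_iterate_channelOp_le hf1 _ _) (measurable_channelFresh (x 0) (x 1))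
    rw [pow_succ, ← mul_assoc]
    convert this using 2 with y
    rw [Function.iterate_succ_apply']
    simp only [channelOp, stateStep, channelStep_eq, Function.comp]

/-- After `i` steps the chain forgets its initial output up to an error of order `v ^ i`. -/
theorem exists_abs_iterate_channelOp_sub_le (h : IsChannelNoise μ v) (hv0 : 0 < v) (hv1 : v < 1)
    {f : (ℕ → 𝒳) × ℝ → ℝ} (hf : Measurable f) (hf1 : ∀ z, |f z| ≤ 1) (i : ℕ) :
    ∃ g : (ℕ → 𝒳) → ℝ, Measurable g ∧ (∀ x, |g x| ≤ 1) ∧ ∀ x y,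
      |(channelOp μ)^[i] f (x, y) - g x|
        ≤ v ^ i * (2 * (∫ e, e ^ 2 ∂(μ 3)) + v⁻¹) + v ^ i * 2 * y ^ 2 := by
  have hE : 0 ≤ ∫ e, e ^ 2 ∂(μ 3) := integral_nonneg fun e => sq_nonneg e
  have hinv : 1 ≤ v⁻¹ := (one_le_inv₀ hv0).2 hv1.le
  -- the first two steps are covered by the trivial bound, at the price of the term `v⁻¹`
  rcases i with _ | _ | i
  · refine ⟨0, measurable_const, by simp, fun x y => ?_⟩
    have := hf1 (x, y)
    simp only [Function.iterate_zero, id, Pi.zero_apply, sub_zero, pow_zero, one_mul]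
    nlinarith [sq_nonneg y]
  · refine ⟨0, measurable_const, by simp, fun x y => ?_⟩
    have := abs_iterate_channelOp_le (μ := μ) hf1 1 (x, y)
    have e : v * v⁻¹ = 1 := mul_inv_cancel₀ hv0.ne'
    have h1 : 0 ≤ v * ∫ e, e ^ 2 ∂(μ 3) := by positivity
    have h2 : 0 ≤ v * y ^ 2 := by positivity
    simp only [zero_add, Pi.zero_apply, sub_zero, pow_one]
    nlinarith
  · set F := (channelOp μ)^[i + 1] f with hF
    have hFm : Measurable F := measurable_iterate_channelOp hf _
    have hF1 : ∀ z, |F z| ≤ 1 := abs_iterate_channelOp_le hf1 _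
    refine ⟨fun x => ∫ r, F (leftShift x, channelFresh (x 0) (x 1) r) ∂(Measure.pi μ), ?_,
      fun x => abs_integral_le_one fun r => hF1 _, fun x y => ?_⟩
    · have hm : Measurable fun p : (ℕ → 𝒳) × (Fin 5 → ℝ) =>
          (leftShift p.1, channelFresh (p.1 0) (p.1 1) p.2) := by
        refine (measurable_leftShift.comp (by fun_prop)).prodMk ?_
        unfold channelFresh
        fun_prop
      have hs : StronglyMeasurable fun p : (ℕ → 𝒳) × (Fin 5 → ℝ) =>
          F (leftShift p.1, channelFresh (p.1 0) (p.1 1) p.2) := (hFm.comp hm).stronglyMeasurable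
      exact (hs.integral_prod_right (ν := Measure.pi μ)).measurable
    · have key := abs_integral_step_sub_le h (f := fun y => F (leftShift x, y))
        (hFm.comp measurable_prodMk_left) (fun _ => hF1 _)
        (secondDiffLE_iterate_channelOp h hf hf1 i (leftShift x)) (x 0) (x 1) y
      rw [Function.iterate_succ_apply', ← hF]
      refine key.trans ?_
      have : 0 ≤ v ^ (i + 1 + 1) * v⁻¹ := by positivity
      have e : 4 * v ^ (i + 1) * v * (y ^ 2 + ∫ e, e ^ 2 ∂(μ 3)) / 2
        = v ^ (i + 1 + 1) * (2 * (∫ e, e ^ 2 ∂(μ 3))) + v ^ (i + 1 + 1) * 2 * y ^ 2 := by ring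
      rw [e, mul_add (v ^ (i + 1 + 1))]
      linarith

/-- The additive constant in the drift inequality for the square of the output; it dominates the
contribution of every pair of consecutive input symbols. -/
noncomputable def driftConst (𝒳 : Finset ℝ) (μ : Fin 5 → Measure ℝ) (v : ℝ) : ℝ :=
  ∑ a ∈ 𝒳, ∑ b ∈ 𝒳, ∫ r, (channelFresh a b r) ^ 2 ∂(Measure.pi μ) + v * ∫ e, e ^ 2 ∂(μ 3)

theorem integral_channelStep_sq_le (h : IsChannelNoise μ v) (a b : 𝒳) (y : ℝ) :
    ∫ r, (channelStep a b r y) ^ 2 ∂(Measure.pi μ) ≤ driftConst 𝒳 μ v + v * y ^ 2 := by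
  have h0 : ∀ a b : ℝ, 0 ≤ ∫ r, (channelFresh a b r) ^ 2 ∂(Measure.pi μ) :=
    fun a b => integral_nonneg fun r => sq_nonneg _
  have h1 : ∫ r, (channelFresh a b r) ^ 2 ∂(Measure.pi μ)
      ≤ ∑ a ∈ 𝒳, ∑ b ∈ 𝒳, ∫ r, (channelFresh a b r) ^ 2 ∂(Measure.pi μ) :=
    (Finset.single_le_sum (f := fun b => ∫ r, (channelFresh a b r) ^ 2 ∂(Measure.pi μ))
      (fun b _ => h0 _ _) b.2).trans
    (Finset.single_le_sum (f := fun a => ∑ b ∈ 𝒳, ∫ r, (channelFresh a b r) ^ 2 ∂(Measure.pi μ))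
      (fun a _ => Finset.sum_nonneg fun b _ => h0 _ _) a.2)
  rw [integral_channelStep_sq h, driftConst]
  linarith

omit [∀ i, IsProbabilityMeasure (μ i)] in
theorem driftConst_nonneg (hv0 : 0 < v) : 0 ≤ driftConst 𝒳 μ v := by
  have hE : 0 ≤ ∫ e, e ^ 2 ∂(μ 3) := integral_nonneg fun e => sq_nonneg e
  have : 0 ≤ ∑ a ∈ 𝒳, ∑ b ∈ 𝒳, ∫ r, (channelFresh a b r) ^ 2 ∂(Measure.pi μ) :=
    Finset.sum_nonneg fun a _ => Finset.sum_nonneg fun b _ => integral_nonneg fun r => sq_nonneg _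
  unfold driftConst
  positivity

theorem abs_channelOp_sub_le (h : IsChannelNoise μ v) {f : (ℕ → 𝒳) × ℝ → ℝ}
    (hf : Measurable f) (hf1 : ∀ z, |f z| ≤ 1) {g : (ℕ → 𝒳) → ℝ} {a b : ℝ} (hb : 0 ≤ b)
    (hfg : ∀ x y, |f (x, y) - g x| ≤ a + b * y ^ 2) (x : ℕ → 𝒳) (y : ℝ) :
    |channelOp μ f (x, y) - g (leftShift x)|
      ≤ (a + b * driftConst 𝒳 μ v) + (b * v) * y ^ 2 := by
  have i1 : Integrable (fun r => f (stateStep (x, y) r)) (Measure.pi μ) :=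
    integrable_comp_of_abs_le_one (hf.comp (measurable_stateStep_right _)) fun _ => hf1 _
  have i2 := ((memLp_channelStep h (x 0) (x 1) y).integrable_sq.const_mul b)
  have e : channelOp μ f (x, y) - g (leftShift x)
      = ∫ r, (f (stateStep (x, y) r) - g (leftShift x)) ∂(Measure.pi μ) := by
    rw [integral_sub i1 (integrable_const _)]; simp [channelOp]
  rw [e]
  calc _ ≤ ∫ r, |f (stateStep (x, y) r) - g (leftShift x)| ∂(Measure.pi μ) :=
        abs_integral_le_integral_abs
    _ ≤ ∫ r, (a + b * (channelStep (x 0) (x 1) r y) ^ 2) ∂(Measure.pi μ) :=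
        integral_mono (i1.sub (integrable_const _)).abs ((integrable_const _).add i2)
          fun r => hfg _ _
    _ = a + b * ∫ r, (channelStep (x 0) (x 1) r y) ^ 2 ∂(Measure.pi μ) := by
        rw [integral_add (integrable_const _) i2, integral_const_mul]; simp
    _ ≤ a + b * (driftConst 𝒳 μ v + v * y ^ 2) := by
        gcongr; exact integral_channelStep_sq_le h _ _ _
    _ = _ := by ring

/-- A bound that is affine in the square of the output is preserved by the chain, uniformly in the
number of steps, by the drift inequality. -/
theorem abs_iterate_channelOp_sub_le (h : IsChannelNoise μ v) (hv0 : 0 < v) (hv1 : v < 1)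
    {f : (ℕ → 𝒳) × ℝ → ℝ} (hf : Measurable f) (hf1 : ∀ z, |f z| ≤ 1) {g : (ℕ → 𝒳) → ℝ}
    {a b : ℝ} (hb : 0 ≤ b) (hfg : ∀ x y, |f (x, y) - g x| ≤ a + b * y ^ 2)
    (m : ℕ) (x : ℕ → 𝒳) (y : ℝ) :
    |(channelOp μ)^[m] f (x, y) - g (leftShift^[m] x)|
      ≤ a + b * (driftConst 𝒳 μ v / (1 - v)) + b * y ^ 2 := by
  set s := driftConst 𝒳 μ v / (1 - v) with hs
  have hs0 : 0 ≤ s := div_nonneg (driftConst_nonneg hv0) (by linarith)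
  have hfix : driftConst 𝒳 μ v + v * s = s := by
    rw [hs]; field_simp [(by linarith : (1 - v) ≠ 0)]; ring
  -- the quantity `a' + b' * s` is left unchanged by a step
  have key : ∃ a' b', 0 ≤ b' ∧ b' ≤ b ∧ a' + b' * s = a + b * s ∧
      ∀ x y, |(channelOp μ)^[m] f (x, y) - g (leftShift^[m] x)| ≤ a' + b' * y ^ 2 := by
    induction m with
    | zero => exact ⟨a, b, hb, le_rfl, rfl, hfg⟩
    | succ m ih =>
      obtain ⟨a', b', h0, h1, h2, h3⟩ := ih
      refine ⟨a' + b' * driftConst 𝒳 μ v, b' * v, by positivity, by nlinarith, ?_, ?_⟩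
      · rw [← h2, add_assoc, mul_assoc, ← mul_add, hfix]
      · intro x y
        rw [Function.iterate_succ_apply', Function.iterate_succ_apply]
        exact abs_channelOp_sub_le h (measurable_iterate_channelOp hf m)
          (abs_iterate_channelOp_le hf1 m) (g := fun x => g (leftShift^[m] x)) h0 h3 x y
  obtain ⟨a', b', h0, h1, h2, h3⟩ := key
  refine (h3 x y).trans ?_
  have : 0 ≤ b' * s := by positivity
  nlinarith [mul_le_mul_of_nonneg_right h1 (sq_nonneg y)]

/-- The constant in the exponential convergence, when the initial output has second moment at most
`V`. -/
noncomputable def rateConst (𝒳 : Finset ℝ) (μ : Fin 5 → Measure ℝ) (v V : ℝ) : ℝ :=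
  2 * (2 * (∫ e, e ^ 2 ∂(μ 3)) + v⁻¹) + 2 * (driftConst 𝒳 μ v / (1 - v)) + 4 * V

/-- For a stationary input, the expectations of a bounded function of the state after `i` and after
`i + m` steps differ by at most a constant times `v ^ i`. Both are compared with the expectation of
one function of the input alone. -/
theorem abs_integral_iterate_channelOp_sub_le (h : IsChannelNoise μ v) (hv0 : 0 < v) (hv1 : v < 1)
    {Q : Measure ((ℕ → 𝒳) × ℝ)} [IsProbabilityMeasure Q]
    (hQ : MeasurePreserving leftShift (Q.map Prod.fst) (Q.map Prod.fst)) {V : ℝ}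
    (hint : Integrable (fun z => z.2 ^ 2) Q) (hV : ∫ z, z.2 ^ 2 ∂Q ≤ V)
    {f : (ℕ → 𝒳) × ℝ → ℝ} (hf : Measurable f) (hf1 : ∀ z, |f z| ≤ 1) (i m : ℕ) :
    |∫ z, (channelOp μ)^[i] f z ∂Q - ∫ z, (channelOp μ)^[m + i] f z ∂Q|
      ≤ rateConst 𝒳 μ v V * v ^ i := by
  obtain ⟨g, hg, hg1, hgb⟩ := exists_abs_iterate_channelOp_sub_le h hv0 hv1 hf hf1 i
  set D := 2 * (∫ e, e ^ 2 ∂(μ 3)) + v⁻¹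
  set s := driftConst 𝒳 μ v / (1 - v)
  have hgs : ∫ z, g (leftShift^[m] z.1) ∂Q = ∫ z, g z.1 ∂Q := by
    have e1 : ∫ x, g x ∂(Q.map Prod.fst) = ∫ z, g z.1 ∂Q :=
      integral_map measurable_fst.aemeasurable hg.aestronglyMeasurable
    have hm : Measurable fun x => g (leftShift^[m] x) :=
      hg.comp (measurable_leftShift.iterate m)
    have e2 : ∫ x, g (leftShift^[m] x) ∂(Q.map Prod.fst) = ∫ z, g (leftShift^[m] z.1) ∂Q :=
      integral_map measurable_fst.aemeasurable hm.aestronglyMeasurable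
    have hmp := hQ.iterate m
    have e3 : ∫ x, g x ∂((Q.map Prod.fst).map leftShift^[m])
        = ∫ x, g (leftShift^[m] x) ∂(Q.map Prod.fst) :=
      integral_map hmp.aemeasurable hg.aestronglyMeasurable
    rw [hmp.map_eq] at e3
    rw [← e1, ← e2, e3]
  have hbd : ∀ (F : (ℕ → 𝒳) × ℝ → ℝ) (G : (ℕ → 𝒳) → ℝ) (a b : ℝ), Measurable F → Measurable G →
      (∀ z, |F z| ≤ 1) → (∀ x, |G x| ≤ 1) → 0 ≤ b → (∀ x y, |F (x, y) - G x| ≤ a + b * y ^ 2) →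
      |∫ z, F z ∂Q - ∫ z, G z.1 ∂Q| ≤ a + b * V := by
    intro F G a b hF hG hF1 hG1 hb hFG
    have i1 : Integrable F Q := integrable_comp_of_abs_le_one hF hF1
    have i2 : Integrable (fun z : (ℕ → 𝒳) × ℝ => G z.1) Q :=
      integrable_comp_of_abs_le_one (hG.comp measurable_fst) fun _ => hG1 _
    rw [← integral_sub i1 i2]
    calc _ ≤ ∫ z, |F z - G z.1| ∂Q := abs_integral_le_integral_abs
      _ ≤ ∫ z, (a + b * z.2 ^ 2) ∂Q :=
          integral_mono (i1.sub i2).abs ((integrable_const _).add (hint.const_mul b))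
            fun z => hFG z.1 z.2
      _ = a + b * ∫ z, z.2 ^ 2 ∂Q := by
          rw [integral_add (integrable_const _) (hint.const_mul b), integral_const_mul]; simp
      _ ≤ _ := by gcongr
  have b1 := hbd _ g _ _ (measurable_iterate_channelOp hf i) hg (abs_iterate_channelOp_le hf1 i) hg1
    (by positivity) hgb
  have b2 := hbd ((channelOp μ)^[m + i] f) (fun x => g (leftShift^[m] x)) (v ^ i * D + v ^ i * 2 * s)
    (v ^ i * 2) (measurable_iterate_channelOp hf (m + i))
    (hg.comp (measurable_leftShift.iterate m)) (abs_iterate_channelOp_le hf1 _) (fun _ => hg1 _)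
    (by positivity) (fun x y => by
      rw [Function.iterate_add_apply]
      exact abs_iterate_channelOp_sub_le h hv0 hv1 (measurable_iterate_channelOp hf i)
        (abs_iterate_channelOp_le hf1 i) (by positivity) hgb m x y)
  rw [hgs] at b2
  have e : rateConst 𝒳 μ v V * v ^ i = (v ^ i * D + v ^ i * 2 * V)
      + (v ^ i * D + v ^ i * 2 * s + v ^ i * 2 * V) := by
    simp only [rateConst, D, s]; ring
  rw [e]
  rw [abs_sub_comm] at b2
  exact (abs_sub_le _ (∫ z, g z.1 ∂Q) _).trans (add_le_add b1 b2)

end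

/-! ### Sequence space: the Markov property and ergodicity -/

/-- A sequence of independent variables splits into its head and its tail. -/
theorem map_head_tail_infinitePi {β : Type*} [MeasurableSpace β] (ρ : Measure β)
    [IsProbabilityMeasure ρ] :
    (Measure.infinitePi fun _ : ℕ => ρ).map (fun ν => (ν 0, leftShift ν))
      = ρ.prod (Measure.infinitePi fun _ : ℕ => ρ) := by
  let cons : β × (ℕ → β) → ℕ → β := fun p n => Nat.casesOn n p.1 p.2
  have hcons : Measurable cons := measurable_pi_lambda _ fun n => by
    cases n <;> simp only [cons] <;> fun_prop
  have hsplit : Measurable fun ν : ℕ → β => (ν 0, leftShift ν) :=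
    (measurable_pi_apply 0).prodMk measurable_leftShift
  have key : (ρ.prod (Measure.infinitePi fun _ : ℕ => ρ)).map cons
      = Measure.infinitePi fun _ : ℕ => ρ := by
    refine Measure.eq_infinitePi _ fun s t ht => ?_
    -- enlarge the index set to an initial segment, the new factors being the whole space
    classical
    set t' : ℕ → Set β := fun i => if i ∈ s then t i else Set.univ
    have ht' : ∀ i, MeasurableSet (t' i) := fun i => by
      simp only [t']; split_ifs; exacts [ht i, MeasurableSet.univ]
    obtain ⟨n, hn⟩ : ∃ n, s ⊆ Finset.range (n + 1) := by
      obtain ⟨n, hn⟩ := s.exists_nat_subset_range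
      exact ⟨n, hn.trans (by simp)⟩
    have hset : cons ⁻¹' (Set.pi s t)
        = t' 0 ×ˢ (Set.pi (Finset.range n) fun i => t' (i + 1)) := by
      ext p
      simp only [Set.mem_preimage, Set.mem_pi, Set.mem_prod, Finset.mem_coe, Finset.mem_range]
      constructor
      · intro hp
        refine ⟨?_, fun i _ => ?_⟩
        · by_cases h : 0 ∈ s
          · simpa [t', h, cons] using hp 0 h
          · simp [t', h]
        · by_cases h : i + 1 ∈ s
          · simpa [t', h] using hp (i + 1) h
          · simp [t', h]
      · rintro ⟨h0, h1⟩ i hi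
        cases i with
        | zero => simpa [t', hi, cons] using h0
        | succ i =>
          have := h1 i (by have := Finset.mem_range.1 (hn hi); omega)
          simpa [t', hi] using this
    have hprod : ∏ i ∈ s, ρ (t i) = ∏ i ∈ Finset.range (n + 1), ρ (t' i) := by
      rw [← Finset.prod_subset hn (f := fun i => ρ (t' i))]
      · exact Finset.prod_congr rfl fun i hi => by simp [t', hi]
      · intro i _ hi; simp [t', hi]
    rw [Measure.map_apply hcons (MeasurableSet.pi s.countable_toSet fun i _ => ht i), hset,
      Measure.prod_prod, Measure.infinitePi_pi _ fun i _ => ht' _, hprod,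
      Finset.prod_range_succ', mul_comm]
  conv_lhs => rw [← key]
  rw [Measure.map_map hsplit hcons]
  exact Measure.map_id

section

variable {𝒳 : Finset ℝ} {μ : Fin 5 → Measure ℝ} {v : ℝ}

/-- The output sequence produced from the input `x`, the initial output `y` and the noise `ν`. -/
def outputPath (x : ℕ → 𝒳) (y : ℝ) (ν : ℕ → Fin 5 → ℝ) : ℕ → ℝ
  | 0 => y
  | n + 1 => channelStep (x n) (x (n + 1)) (ν n) (outputPath x y ν n)

/-- The input sequence together with the output sequence. -/
def ioPath (p : ((ℕ → 𝒳) × ℝ) × (ℕ → Fin 5 → ℝ)) : (ℕ → 𝒳) × (ℕ → ℝ) :=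
  (p.1.1, outputPath p.1.1 p.1.2 p.2)

theorem measurable_ioPath :
    Measurable (ioPath : ((ℕ → 𝒳) × ℝ) × (ℕ → Fin 5 → ℝ) → _) := by
  refine (measurable_fst.comp measurable_fst).prodMk (measurable_pi_lambda _ fun n => ?_)
  induction n with
  | zero => exact measurable_snd.comp measurable_fst
  | succ n ih =>
    simp only [outputPath, channelStep]
    fun_prop

theorem leftShift_outputPath (x : ℕ → 𝒳) (y : ℝ) (ν : ℕ → Fin 5 → ℝ) :
    leftShift (outputPath x y ν)
      = outputPath (leftShift x) (channelStep (x 0) (x 1) (ν 0) y) (leftShift ν) := by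
  funext n
  induction n with
  | zero => rfl
  | succ n ih =>
    simp only [leftShift] at ih
    simp only [leftShift, outputPath, ← ih]

theorem leftShiftPair_ioPath (z : (ℕ → 𝒳) × ℝ) (ν : ℕ → Fin 5 → ℝ) :
    leftShiftPair (ioPath (z, ν)) = ioPath (stateStep z (ν 0), leftShift ν) := by
  simp only [leftShiftPair, ioPath, stateStep, leftShift_outputPath]

variable [∀ i, IsProbabilityMeasure (μ i)]

/-- The probability that the pair of input and output sequences lies in `S`, given the input
sequence and the initial output. -/
noncomputable def eventProb (μ : Fin 5 → Measure ℝ) [∀ i, IsProbabilityMeasure (μ i)]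
    (S : Set ((ℕ → 𝒳) × (ℕ → ℝ))) (z : (ℕ → 𝒳) × ℝ) : ℝ :=
  ∫ ν, S.indicator (fun _ => (1 : ℝ)) (ioPath (z, ν))
    ∂(Measure.infinitePi fun _ : ℕ => Measure.pi μ)

theorem abs_indicator_one_le {α : Type*} (S : Set α) (a : α) :
    |S.indicator (fun _ => (1 : ℝ)) a| ≤ 1 := by
  by_cases h : a ∈ S <;> simp [h]

theorem abs_eventProb_le (S : Set ((ℕ → 𝒳) × (ℕ → ℝ))) (z : (ℕ → 𝒳) × ℝ) :
    |eventProb μ S z| ≤ 1 :=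
  abs_integral_le_one fun _ => abs_indicator_one_le _ _

theorem measurable_indicator_ioPath {S : Set ((ℕ → 𝒳) × (ℕ → ℝ))} (hS : MeasurableSet S) :
    Measurable fun p => S.indicator (fun _ => (1 : ℝ)) (ioPath p) :=
  (measurable_const.indicator hS).comp measurable_ioPath

theorem measurable_eventProb {S : Set ((ℕ → 𝒳) × (ℕ → ℝ))} (hS : MeasurableSet S) :
    Measurable (eventProb μ S) :=
  ((measurable_indicator_ioPath hS).stronglyMeasurable.integral_prod_right
    (f := fun z ν => S.indicator (fun _ => (1 : ℝ)) (ioPath (z, ν)))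
    (ν := Measure.infinitePi fun _ : ℕ => Measure.pi μ)).measurable

theorem integral_eventProb {S : Set ((ℕ → 𝒳) × (ℕ → ℝ))} (hS : MeasurableSet S)
    (Q : Measure ((ℕ → 𝒳) × ℝ)) [IsProbabilityMeasure Q] :
    ∫ z, eventProb μ S z ∂Q
      = ((Q.prod (Measure.infinitePi fun _ : ℕ => Measure.pi μ)).map ioPath).real S := by
  have hi : Integrable (fun p => S.indicator (fun _ => (1 : ℝ)) (ioPath p))
      (Q.prod (Measure.infinitePi fun _ : ℕ => Measure.pi μ)) :=
    integrable_comp_of_abs_le_one (measurable_indicator_ioPath hS) fun _ => abs_indicator_one_le _ _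
  have := integral_prod _ hi
  rw [eq_comm] at this
  simp only [eventProb]
  rw [this, ← integral_map (φ := ioPath) (f := S.indicator fun _ => (1 : ℝ))
    measurable_ioPath.aemeasurable (measurable_const.indicator hS).aestronglyMeasurable,
    integral_indicator_const _ hS]
  simp

/-- The Markov property at time one, for an event that restricts the present to `C` and the future
to `S`. -/
theorem eventProb_inter_preimage {C : Set (𝒳 × ℝ)} {S : Set ((ℕ → 𝒳) × (ℕ → ℝ))}
    (hS : MeasurableSet S) (z : (ℕ → 𝒳) × ℝ) :
    eventProb μ ({w | (w.1 0, w.2 0) ∈ C} ∩ leftShiftPair ⁻¹' S) z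
      = C.indicator (fun _ => (1 : ℝ)) (z.1 0, z.2) * channelOp μ (eventProb μ S) z := by
  have h1 : ∀ ν, ({w | (w.1 0, w.2 0) ∈ C} ∩ leftShiftPair ⁻¹' S).indicator
        (fun _ => (1 : ℝ)) (ioPath (z, ν))
      = C.indicator (fun _ => (1 : ℝ)) (z.1 0, z.2)
        * S.indicator (fun _ => (1 : ℝ)) (ioPath (stateStep z (ν 0), leftShift ν)) := by
    intro ν
    rw [← leftShiftPair_ioPath]
    have h0 : (((ioPath (z, ν)).1 0, (ioPath (z, ν)).2 0) : 𝒳 × ℝ) = (z.1 0, z.2) := rfl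
    by_cases hC : (z.1 0, z.2) ∈ C <;> by_cases hT : leftShiftPair (ioPath (z, ν)) ∈ S <;>
      simp [Set.indicator, h0, hC, hT]
  have hm : Measurable fun p : (Fin 5 → ℝ) × (ℕ → Fin 5 → ℝ) =>
      S.indicator (fun _ => (1 : ℝ)) (ioPath (stateStep z p.1, p.2)) :=
    (measurable_indicator_ioPath hS).comp
      (((measurable_stateStep_right z).comp measurable_fst).prodMk measurable_snd)
  have hsplit : Measurable fun ν : ℕ → Fin 5 → ℝ => (ν 0, leftShift ν) :=
    (measurable_pi_apply 0).prodMk measurable_leftShift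
  simp only [eventProb, h1]
  rw [integral_const_mul]
  congr 1
  rw [← integral_map (φ := fun ν : ℕ → Fin 5 → ℝ => (ν 0, leftShift ν))
    (f := fun p : (Fin 5 → ℝ) × (ℕ → Fin 5 → ℝ) =>
      S.indicator (fun _ => (1 : ℝ)) (ioPath (stateStep z p.1, p.2)))
    hsplit.aemeasurable hm.aestronglyMeasurable, map_head_tail_infinitePi,
    integral_prod _ (integrable_comp_of_abs_le_one hm fun _ => abs_indicator_one_le _ _)]
  rfl

theorem eventProb_preimage {S : Set ((ℕ → 𝒳) × (ℕ → ℝ))} (hS : MeasurableSet S) :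
    eventProb μ (leftShiftPair ⁻¹' S) = channelOp μ (eventProb μ S) := by
  funext z
  simpa using eventProb_inter_preimage (C := Set.univ) hS z

theorem eventProb_preimage_iterate {S : Set ((ℕ → 𝒳) × (ℕ → ℝ))} (hS : MeasurableSet S) (i : ℕ) :
    eventProb μ (leftShiftPair^[i] ⁻¹' S) = (channelOp μ)^[i] (eventProb μ S) := by
  induction i with
  | zero => rfl
  | succ i ih =>
    rw [Function.iterate_succ, Set.preimage_comp, eventProb_preimage
      (measurable_leftShiftPair.iterate i hS), ih, Function.iterate_succ_apply']

/-- The laws of the input and output sequences seen from times `i` and `i + m` differ by at most a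
constant times `v ^ i`, uniformly over all events. -/
theorem abs_measureReal_preimage_iterate_sub_le (h : IsChannelNoise μ v) (hv0 : 0 < v) (hv1 : v < 1)
    {Q : Measure ((ℕ → 𝒳) × ℝ)} [IsProbabilityMeasure Q]
    (hQ : MeasurePreserving leftShift (Q.map Prod.fst) (Q.map Prod.fst)) {V : ℝ}
    (hint : Integrable (fun z => z.2 ^ 2) Q) (hV : ∫ z, z.2 ^ 2 ∂Q ≤ V)
    {S : Set ((ℕ → 𝒳) × (ℕ → ℝ))} (hS : MeasurableSet S) {i j : ℕ} (hij : i ≤ j) :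
    |((Q.prod (Measure.infinitePi fun _ : ℕ => Measure.pi μ)).map ioPath).real
        (leftShiftPair^[i] ⁻¹' S)
      - ((Q.prod (Measure.infinitePi fun _ : ℕ => Measure.pi μ)).map ioPath).real
        (leftShiftPair^[j] ⁻¹' S)| ≤ rateConst 𝒳 μ v V * v ^ i := by
  obtain ⟨m, rfl⟩ := Nat.exists_eq_add_of_le' hij
  rw [← integral_eventProb (measurable_leftShiftPair.iterate _ hS),
    ← integral_eventProb (measurable_leftShiftPair.iterate _ hS),
    eventProb_preimage_iterate hS, eventProb_preimage_iterate hS]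
  exact abs_integral_iterate_channelOp_sub_le h hv0 hv1 hQ hint hV (measurable_eventProb hS)
    (abs_eventProb_le S) i m

/-- The conditional probability of an invariant event does not depend on the initial output, and
as a function of the input it is invariant. -/
theorem exists_eventProb_eq_of_invariant (h : IsChannelNoise μ v) (hv0 : 0 < v) (hv1 : v < 1)
    {A : Set ((ℕ → 𝒳) × (ℕ → ℝ))} (hA : MeasurableSet A) (hinv : leftShiftPair ⁻¹' A = A) :
    ∃ g : (ℕ → 𝒳) → ℝ, Measurable g ∧ (∀ x, g (leftShift x) = g x) ∧
      ∀ z, eventProb μ A z = g z.1 := by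
  have hit : ∀ i, (channelOp μ)^[i] (eventProb μ A) = eventProb μ A := by
    intro i
    refine Function.iterate_fixed ?_ i
    rw [← eventProb_preimage hA, hinv]
  have hindep : ∀ x y, eventProb μ A (x, y) = eventProb μ A (x, 0) := by
    intro x y
    set D := 2 * (∫ e, e ^ 2 ∂(μ 3)) + v⁻¹
    have hb : ∀ i : ℕ, |eventProb μ A (x, y) - eventProb μ A (x, 0)|
        ≤ v ^ i * (2 * D + 2 * y ^ 2) := by
      intro i
      obtain ⟨g, -, -, hg⟩ := exists_abs_iterate_channelOp_sub_le h hv0 hv1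
        (measurable_eventProb hA) (abs_eventProb_le (μ := μ) A) i
      rw [hit] at hg
      have h1 := hg x y
      have h2 := hg x 0
      rw [abs_sub_comm] at h2
      refine (abs_sub_le _ (g x) _).trans ((add_le_add h1 h2).trans (le_of_eq ?_))
      simp only [D]; ring
    have hlim : Tendsto (fun i : ℕ => v ^ i * (2 * D + 2 * y ^ 2)) atTop (𝓝 0) := by
      simpa using (tendsto_pow_atTop_nhds_zero_of_lt_one hv0.le hv1).mul_const (2 * D + 2 * y ^ 2)
    have := ge_of_tendsto' hlim hb
    exact sub_eq_zero.1 (abs_nonpos_iff.1 this)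
  refine ⟨fun x => eventProb μ A (x, 0), (measurable_eventProb (μ := μ) hA).comp (by fun_prop),
    fun x => ?_, fun z => hindep z.1 z.2⟩
  have h1 := congrFun (hit 1) (x, 0)
  rw [Function.iterate_one] at h1
  have h2 : channelOp μ (eventProb μ A) (x, 0)
      = ∫ _, eventProb μ A (leftShift x, 0) ∂(Measure.pi μ) :=
    integral_congr_ae (ae_of_all _ fun r => hindep _ _)
  rw [h1] at h2
  simpa using h2.symm

theorem measurableSet_cylinder (n : ℕ) {t : ℕ → Set (𝒳 × ℝ)} (ht : ∀ i, MeasurableSet (t i)) :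
    MeasurableSet {w : (ℕ → 𝒳) × (ℕ → ℝ) | ∀ i < n, (w.1 i, w.2 i) ∈ t i} := by
  simp only [Set.ofPred_forall]
  refine MeasurableSet.iInter fun i => MeasurableSet.iInter fun _ => ?_
  exact (ht i).preimage (by fun_prop)

/-- Conditionally on the input, an invariant event is independent of every event concerning the
first `n` letters and outputs. -/
theorem eventProb_inter_cylinder {A : Set ((ℕ → 𝒳) × (ℕ → ℝ))} (hA : MeasurableSet A)
    (hinv : leftShiftPair ⁻¹' A = A) {g : (ℕ → 𝒳) → ℝ} (hg : ∀ x, g (leftShift x) = g x)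
    (hgA : ∀ z, eventProb μ A z = g z.1) (n : ℕ) (t : ℕ → Set (𝒳 × ℝ))
    (ht : ∀ i, MeasurableSet (t i)) (z : (ℕ → 𝒳) × ℝ) :
    eventProb μ (A ∩ {w | ∀ i < n, (w.1 i, w.2 i) ∈ t i}) z
      = g z.1 * eventProb μ {w | ∀ i < n, (w.1 i, w.2 i) ∈ t i} z := by
  induction n generalizing t z with
  | zero =>
    have h1 : eventProb μ Set.univ z = 1 := by simp [eventProb]
    simp [hgA, h1]
  | succ n ih =>
    set S : Set ((ℕ → 𝒳) × (ℕ → ℝ)) := {w | ∀ i < n, (w.1 i, w.2 i) ∈ t (i + 1)} with hSdef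
    have hS : MeasurableSet S := measurableSet_cylinder n fun i => ht (i + 1)
    have e : {w : (ℕ → 𝒳) × (ℕ → ℝ) | ∀ i < n + 1, (w.1 i, w.2 i) ∈ t i}
        = {w | (w.1 0, w.2 0) ∈ t 0} ∩ leftShiftPair ⁻¹' S := by
      ext w
      simp only [hSdef, Nat.forall_lt_succ_left', Set.mem_ofPred_eq, Set.mem_inter_iff,
        Set.mem_preimage, leftShiftPair, leftShift]
    have e' : A ∩ {w : (ℕ → 𝒳) × (ℕ → ℝ) | ∀ i < n + 1, (w.1 i, w.2 i) ∈ t i}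
        = {w | (w.1 0, w.2 0) ∈ t 0} ∩ leftShiftPair ⁻¹' (A ∩ S) := by
      rw [e, Set.preimage_inter, hinv, Set.inter_left_comm]
    rw [e', e, eventProb_inter_preimage (hA.inter hS), eventProb_inter_preimage hS]
    have : channelOp μ (eventProb μ (A ∩ S)) z = g z.1 * channelOp μ (eventProb μ S) z := by
      simp only [channelOp]
      rw [← integral_const_mul]
      refine integral_congr_ae (ae_of_all _ fun r => ?_)
      simp only
      rw [hSdef, ih (fun i => t (i + 1)) fun i => ht (i + 1)]
      simp only [stateStep, hg]
    rw [this]; ring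

/-- If the input is ergodic, so is the pair of input and output. -/
theorem preErgodic_map_ioPath (h : IsChannelNoise μ v) (hv0 : 0 < v) (hv1 : v < 1)
    {Q : Measure ((ℕ → 𝒳) × ℝ)} [IsProbabilityMeasure Q]
    (hQ : Ergodic leftShift (Q.map Prod.fst)) :
    PreErgodic leftShiftPair
      ((Q.prod (Measure.infinitePi fun _ : ℕ => Measure.pi μ)).map ioPath) := by
  set M := (Q.prod (Measure.infinitePi fun _ : ℕ => Measure.pi μ)).map ioPath with hM
  have : IsProbabilityMeasure M := Measure.isProbabilityMeasure_map measurable_ioPath.aemeasurable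
  refine ⟨fun A hA hinv => ?_⟩
  obtain ⟨g, hgm, hg, hgA⟩ := exists_eventProb_eq_of_invariant h hv0 hv1 hA hinv
  obtain ⟨c, hc⟩ := hQ.toPreErgodic.ae_eq_const_of_ae_eq_comp hgm (funext hg)
  have hcQ : ∀ᵐ z ∂Q, g z.1 = c := ae_of_ae_map measurable_fst.aemeasurable hc
  have hcyl : ∀ (n : ℕ) (t : ℕ → Set (𝒳 × ℝ)), (∀ i, MeasurableSet (t i)) →
      M.real (A ∩ {w | ∀ i < n, (w.1 i, w.2 i) ∈ t i})
        = c * M.real {w | ∀ i < n, (w.1 i, w.2 i) ∈ t i} := by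
    intro n t ht
    have hS := measurableSet_cylinder n ht
    rw [hM, ← integral_eventProb hS, ← integral_eventProb (hA.inter hS), ← integral_const_mul]
    refine integral_congr_ae (hcQ.mono fun z hz => ?_)
    simp only
    rw [eventProb_inter_cylinder hA hinv hg hgA n t ht z, hz]
  have hcA : M.real A = c := by simpa using hcyl 0 (fun _ => Set.univ) fun _ => MeasurableSet.univ
  have hc0 : 0 ≤ c := hcA ▸ measureReal_nonneg
  -- the event `A` is independent of every event, in particular of itself
  let e := MeasurableEquiv.arrowProdEquivProdArrow 𝒳 ℝ ℕ
  have hmeq : (M.restrict A).map e.symm = (ENNReal.ofReal c • M).map e.symm := by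
    refine ext_of_generate_finite _ generateFrom_squareCylinders.symm
      (isPiSystem_squareCylinders (fun _ => MeasurableSpace.isPiSystem_measurableSet) (by simp)) ?_ ?_
    · rintro B ⟨s, t, ht, rfl⟩
      classical
      have ht1 : ∀ i, MeasurableSet (t i) := fun i => ht i (Set.mem_univ i)
      obtain ⟨n, hn⟩ := s.exists_nat_subset_range
      have hB : MeasurableSet (Set.pi (s : Set ℕ) t) :=
        MeasurableSet.pi s.countable_toSet fun i _ => ht1 i
      have hpre : e.symm ⁻¹' (Set.pi s t)
          = {w | ∀ i < n, (w.1 i, w.2 i) ∈ if i ∈ s then t i else Set.univ} := by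
        ext w
        simp only [Set.mem_preimage, Set.mem_pi, Finset.mem_coe, Set.mem_ofPred_eq]
        constructor
        · intro hw i _
          split_ifs with hi
          · exact hw i hi
          · trivial
        · intro hw i hi
          have := hw i (Finset.mem_range.1 (hn hi))
          rwa [if_pos hi] at this
      rw [Measure.map_apply e.symm.measurable hB, Measure.map_apply e.symm.measurable hB,
        Measure.restrict_apply (e.symm.measurable hB), Set.inter_comm, Measure.smul_apply,
        smul_eq_mul, hpre]
      have := hcyl n (fun i => if i ∈ s then t i else Set.univ) fun i => by
        split_ifs; exacts [ht1 i, MeasurableSet.univ]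
      rw [← ENNReal.ofReal_toReal (measure_ne_top M (A ∩ _)),
        ← ENNReal.ofReal_toReal (measure_ne_top M {w | _}), ← ENNReal.ofReal_mul hc0]
      exact congrArg _ this
    · rw [Measure.map_apply e.symm.measurable MeasurableSet.univ,
        Measure.map_apply e.symm.measurable MeasurableSet.univ]
      simp [← hcA]
  have hmeq' : M.restrict A = ENNReal.ofReal c • M := e.symm.map_measurableEquiv_injective hmeq
  have hAA := congrArg (fun m => m.real A) hmeq'
  simp only [measureReal_restrict_apply hA, Set.inter_self, measureReal_ennreal_smul_apply,
    ENNReal.toReal_ofReal hc0, hcA] at hAA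
  rw [eventuallyConst_set']
  have hz : c = 0 ∨ c = 1 := by
    have : c * (c - 1) = 0 := by linarith
    rcases mul_eq_zero.1 this with h | h
    · exact Or.inl h
    · exact Or.inr (by linarith)
  rcases hz with rfl | rfl
  · left
    exact ae_eq_empty.2 ((measureReal_eq_zero_iff).1 hcA)
  · right
    rw [ae_eq_univ_iff_measure_eq hA.nullMeasurableSet, measure_univ]
    rw [measureReal_def] at hcA
    rw [← ENNReal.ofReal_toReal (measure_ne_top M A), hcA, ENNReal.ofReal_one]

end

/-! ### Stationary means of asymptotically stationary laws -/

section

variable {S : Type*} [MeasurableSpace S] {T : S → S} {μ : Measure S} {ε : ℕ → ℝ}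

theorem tendsto_cesaro_Icc {u : ℕ → ℝ} {l : ℝ} (hu : Tendsto u atTop (𝓝 l)) :
    Tendsto (fun n : ℕ => (1 / (n : ℝ)) * ∑ i ∈ Finset.Icc 1 n, u i) atTop (𝓝 l) := by
  have h := (hu.comp (tendsto_add_atTop_nat 1)).cesaro
  refine h.congr fun n => ?_
  rw [one_div]
  congr 1
  rw [Finset.range_eq_Ico, ← Finset.Ico_add_one_right_eq_Icc, ← Finset.sum_Ico_add' u 0 n 1]
  rfl

theorem cauchySeq_of_abs_sub_le {u : ℕ → ℝ} (hε : Tendsto ε atTop (𝓝 0))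
    (h : ∀ i j, i ≤ j → |u i - u j| ≤ ε i) : CauchySeq u := by
  refine Metric.cauchySeq_iff'.2 fun δ hδ => ?_
  obtain ⟨N, hN⟩ := ((tendsto_order.1 hε).2 δ hδ).exists
  refine ⟨N, fun n hn => ?_⟩
  rw [dist_comm, Real.dist_eq]
  exact (h N n hn).trans_lt hN

/-- If the laws of the shifted process form a Cauchy sequence uniformly over all events, their
setwise limit is a measure, and it is the stationary mean. -/
theorem isAsymptoticallyMeanStationary_of_abs_sub_le [IsProbabilityMeasure μ] (hT : Measurable T)
    (hε : Tendsto ε atTop (𝓝 0))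
    (h : ∀ A, MeasurableSet A → ∀ i j, i ≤ j →
      |μ.real (T^[i] ⁻¹' A) - μ.real (T^[j] ⁻¹' A)| ≤ ε i) :
    IsAsymptoticallyMeanStationary T μ := by
  have hex : ∀ A : Set S, ∃ l : ℝ, MeasurableSet A →
      Tendsto (fun i => μ.real (T^[i] ⁻¹' A)) atTop (𝓝 l) := by
    intro A
    by_cases hA : MeasurableSet A
    · obtain ⟨l, hl⟩ := cauchySeq_tendsto_of_complete (cauchySeq_of_abs_sub_le hε (h A hA))
      exact ⟨l, fun _ => hl⟩
    · exact ⟨0, fun h => absurd h hA⟩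
  choose F hF using hex
  have hF0 : ∀ A, MeasurableSet A → 0 ≤ F A := fun A hA =>
    ge_of_tendsto' (hF A hA) fun i => measureReal_nonneg
  have hFb : ∀ A, MeasurableSet A → ∀ i, |μ.real (T^[i] ⁻¹' A) - F A| ≤ ε i := by
    intro A hA i
    refine le_of_tendsto ((tendsto_const_nhds.sub (hF A hA)).abs) ?_
    filter_upwards [eventually_ge_atTop i] with j hj
    exact h A hA i j hj
  have hFsum : ∀ f : ℕ → Set S, (∀ k, MeasurableSet (f k)) → Pairwise (Function.onFun Disjoint f) →
      HasSum (fun k => F (f k)) (F (⋃ k, f k)) := by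
    intro f hf hd
    have hd' : ∀ i, Pairwise (Function.onFun Disjoint fun k => T^[i] ⁻¹' f k) :=
      fun i a b hab => (hd hab).preimage _
    have hm : ∀ i k, MeasurableSet (T^[i] ⁻¹' f k) := fun i k => hT.iterate i (hf k)
    have hfin : ∀ n, ∑ k ∈ Finset.range n, F (f k) = F (⋃ k ∈ Finset.range n, f k) := by
      intro n
      have hU : MeasurableSet (⋃ k ∈ Finset.range n, f k) :=
        Finset.measurableSet_biUnion _ fun k _ => hf k
      refine tendsto_nhds_unique (tendsto_finsetSum _ fun k _ => hF (f k) (hf k))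
        ((hF _ hU).congr fun i => ?_)
      simp only [Set.preimage_iUnion]
      exact measureReal_biUnion_finset (fun a _ b _ hab => hd' i hab) fun k _ => hm i k
    rw [hasSum_iff_tendsto_nat_of_nonneg fun k => hF0 _ (hf k)]
    refine Metric.tendsto_atTop.2 fun δ hδ => ?_
    -- compare with the law at a time `i` that is uniformly close to the limit
    obtain ⟨i, hi⟩ := ((tendsto_order.1 hε).2 (δ / 3) (by positivity)).exists
    have hsum : HasSum (fun k => μ.real (T^[i] ⁻¹' f k)) (μ.real (T^[i] ⁻¹' ⋃ k, f k)) := by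
      rw [Set.preimage_iUnion]
      simp only [measureReal_def]
      rw [measure_iUnion (hd' i) (hm i), ENNReal.tsum_toReal_eq fun k => measure_ne_top _ _]
      refine ENNReal.hasSum_toReal ?_
      rw [← measure_iUnion (hd' i) (hm i)]
      exact measure_ne_top _ _
    obtain ⟨N, hN⟩ := Metric.tendsto_atTop.1 hsum.tendsto_sum_nat (δ / 3) (by positivity)
    refine ⟨N, fun n hn => ?_⟩
    have hU : MeasurableSet (⋃ k ∈ Finset.range n, f k) :=
      Finset.measurableSet_biUnion _ fun k _ => hf k
    have h1 := hFb _ hU i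
    have h2 := hFb _ (MeasurableSet.iUnion hf) i
    have h3 := hN n hn
    have e : ∑ k ∈ Finset.range n, μ.real (T^[i] ⁻¹' f k)
        = μ.real (T^[i] ⁻¹' ⋃ k ∈ Finset.range n, f k) := by
      simp only [Set.preimage_iUnion]
      exact (measureReal_biUnion_finset (fun a _ b _ hab => hd' i hab) fun k _ => hm i k).symm
    rw [Real.dist_eq, e] at h3
    rw [Real.dist_eq, hfin]
    rw [abs_le] at h1 h2
    rw [abs_lt] at h3 ⊢
    constructor <;> linarith [h1.1, h1.2, h2.1, h2.2, h3.1, h3.2]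
  have hempty : F ∅ = 0 := by
    refine tendsto_nhds_unique (hF ∅ MeasurableSet.empty) ?_
    simp
  have huniv : F Set.univ = 1 := by
    refine tendsto_nhds_unique (hF _ MeasurableSet.univ) ?_
    simp
  let ν : Measure S := Measure.ofMeasurable (fun A _ => ENNReal.ofReal (F A)) (by simp [hempty])
    fun f hf hd => by
      rw [← (hFsum f hf hd).tsum_eq]
      exact ENNReal.ofReal_tsum_of_nonneg (fun k => hF0 _ (hf k)) (hFsum f hf hd).summable
  have hν : ∀ A, MeasurableSet A → ν A = ENNReal.ofReal (F A) := fun A hA =>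
    Measure.ofMeasurable_apply A hA
  refine ⟨ν, ⟨by rw [hν _ MeasurableSet.univ, huniv, ENNReal.ofReal_one]⟩, fun A hA => ?_⟩
  rw [measureReal_def, hν A hA, ENNReal.toReal_ofReal (hF0 A hA)]
  exact tendsto_cesaro_Icc (hF A hA)

/-- When the probabilities of a shifted event form a Cauchy sequence, they converge to the
probability under the stationary mean, with the same error bound. -/
theorem abs_measureReal_sub_stationaryMean_le {ν : Measure S} (hν : IsStationaryMean T μ ν)
    (hε : Tendsto ε atTop (𝓝 0)) {A : Set S} (hA : MeasurableSet A)
    (h : ∀ i j, i ≤ j → |μ.real (T^[i] ⁻¹' A) - μ.real (T^[j] ⁻¹' A)| ≤ ε i) (k : ℕ) :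
    |μ.real (T^[k] ⁻¹' A) - ν.real A| ≤ ε k := by
  obtain ⟨l, hl⟩ := cauchySeq_tendsto_of_complete (cauchySeq_of_abs_sub_le hε h)
  have : ν.real A = l := tendsto_nhds_unique (hν.2 A hA) (tendsto_cesaro_Icc hl)
  rw [this]
  refine le_of_tendsto ((tendsto_const_nhds.sub hl).abs) ?_
  filter_upwards [eventually_ge_atTop k] with j hj
  exact h k j hj

end

/-! ### Reduction of the channel to independent driving noise -/

/-- Subfamilies of an independent family over disjoint, possibly infinite, index sets are
independent. -/
theorem iIndepFun_indepFun_of_disjoint {Ω ι : Type*} [MeasurableSpace Ω] {P : Measure Ω}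
    {β : ι → Type*} [∀ i, MeasurableSpace (β i)] {f : ∀ i, Ω → β i} (h : iIndepFun f P)
    (hf : ∀ i, Measurable (f i)) {S T : Set ι} (hST : Disjoint S T) :
    IndepFun (fun ω (i : S) => f i ω) (fun ω (i : T) => f i ω) P := by
  have key := indep_iSup_of_disjoint (fun i => (hf i).comap_le)
    ((iIndepFun_iff_iIndep _ f P).1 h) hST
  have hle : ∀ R : Set ι, MeasurableSpace.comap (fun ω (i : R) => f i ω) inferInstance
      ≤ ⨆ i ∈ R, MeasurableSpace.comap (f i) inferInstance := by
    intro R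
    rw [← measurable_iff_comap_le]
    refine @measurable_pi_lambda _ _ _ (⨆ i ∈ R, MeasurableSpace.comap (f i) inferInstance) _ _
      fun i => ?_
    exact measurable_iff_comap_le.2
      (le_iSup₂ (f := fun i (_ : i ∈ R) => MeasurableSpace.comap (f i) inferInstance) i.1 i.2)
  rw [IndepFun_iff_Indep]
  exact indep_of_indep_of_le_left (indep_of_indep_of_le_right key (hle T)) (hle S)

theorem indepFun_prodMk_of_indepFun {Ω α β γ : Type*} [MeasurableSpace Ω] [MeasurableSpace α]
    [MeasurableSpace β] [MeasurableSpace γ] {P : Measure Ω} [IsProbabilityMeasure P]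
    {X : Ω → α} {I : Ω → β} {N : Ω → γ} (hX : Measurable X) (hI : Measurable I) (hN : Measurable N)
    (h1 : IndepFun X (fun ω => (I ω, N ω)) P) (h2 : IndepFun I N P) :
    IndepFun (fun ω => (X ω, I ω)) N P := by
  have hXI : IndepFun X I P := h1.comp measurable_id measurable_fst
  have e1 := (indepFun_iff_map_prod_eq_prod_map_map hX.aemeasurable (hI.prodMk hN).aemeasurable).1 h1
  have e2 := (indepFun_iff_map_prod_eq_prod_map_map hI.aemeasurable hN.aemeasurable).1 h2
  have e3 := (indepFun_iff_map_prod_eq_prod_map_map hX.aemeasurable hI.aemeasurable).1 hXI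
  have := Measure.isProbabilityMeasure_map (μ := P) hX.aemeasurable
  have := Measure.isProbabilityMeasure_map (μ := P) hI.aemeasurable
  have := Measure.isProbabilityMeasure_map (μ := P) hN.aemeasurable
  rw [indepFun_iff_map_prod_eq_prod_map_map (hX.prodMk hI).aemeasurable hN.aemeasurable, e3]
  have hassoc := (measurePreserving_prodAssoc (P.map X) (P.map I) (P.map N)).symm.map_eq
  rw [← hassoc, ← e2, ← e1, Measure.map_map (MeasurableEquiv.measurable _)
    (hX.prodMk (hI.prodMk hN))]
  rfl

/-- The laws of the noise variables, in the order `B`, `W`, `A`, `E`, `U`. -/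
noncomputable def channelNoise (σA σB σE : ℝ≥0) (α₁ α₂ : ℝ) : Fin 5 → Measure ℝ :=
  ![gaussianReal 0 (σB ^ 2), gaussianReal 0 1, gaussianReal 0 (σA ^ 2), gaussianReal 0 (σE ^ 2),
    ProbabilityTheory.cond volume (Set.Ioo α₁ α₂)]

section

variable {σA σB σE : ℝ≥0} {α₁ α₂ : ℝ}

theorem isProbabilityMeasure_channelNoise (hα : α₁ < α₂) (i : Fin 5) :
    IsProbabilityMeasure (channelNoise σA σB σE α₁ α₂ i) := by
  have hU : IsProbabilityMeasure (ProbabilityTheory.cond volume (Set.Ioo α₁ α₂)) := by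
    refine cond_isProbabilityMeasure_of_finite ?_ ?_ <;> simp [hα]
  fin_cases i
  exacts [inferInstanceAs (IsProbabilityMeasure (gaussianReal 0 (σB ^ 2))),
    inferInstanceAs (IsProbabilityMeasure (gaussianReal 0 1)),
    inferInstanceAs (IsProbabilityMeasure (gaussianReal 0 (σA ^ 2))),
    inferInstanceAs (IsProbabilityMeasure (gaussianReal 0 (σE ^ 2))), hU]

theorem isChannelNoise_channelNoise (hα : α₁ < α₂) :
    IsChannelNoise (channelNoise σA σB σE α₁ α₂) ((σB : ℝ) ^ 2) where
  memLp i := by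
    have hU : MemLp id 2 (ProbabilityTheory.cond volume (Set.Ioo α₁ α₂)) := by
      have : IsProbabilityMeasure (ProbabilityTheory.cond volume (Set.Ioo α₁ α₂)) :=
        isProbabilityMeasure_channelNoise (σA := σA) (σB := σB) (σE := σE) hα 4
      refine MemLp.of_bound aestronglyMeasurable_id (max |α₁| |α₂|) ?_
      refine (ae_cond_mem measurableSet_Ioo).mono fun u hu => ?_
      rw [id, Real.norm_eq_abs]
      exact abs_le_max_abs_abs hu.1.le hu.2.le
    fin_cases i <;> simp only [channelNoise] <;>
      first | exact hU | exact memLp_id_gaussianReal' 2 (by norm_num)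
  symm := by
    simpa [channelNoise] using gaussianReal_map_neg (μ := 0) (v := σB ^ 2)
  second_moment := by
    have h := variance_fun_id_gaussianReal (μ := 0) (v := σB ^ 2)
    rw [variance_of_integral_eq_zero (by fun_prop) (integral_id_gaussianReal (μ := 0))] at h
    simpa [channelNoise] using h
  gaussian := rfl
  mean_zero := integral_id_gaussianReal (μ := 0)

variable {𝒳 : Finset ℝ} {Ω : Type*} [MeasurableSpace Ω] {P : Measure Ω}
  {X : ℕ → Ω → 𝒳} {A B E W U Y : ℕ → Ω → ℝ}

/-- Extraction from the noise processes `B`, `W`, `A`, `E`, `U` of the two variables that enter the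
initial output, and of the sequence of noise vectors that drive the later outputs. The variable `E`
enters with a delay of one step, so that its time index is not shifted. -/
def noiseSplit (V : Fin 5 → ℕ → ℝ) : (ℝ × ℝ) × (ℕ → Fin 5 → ℝ) :=
  ((V 1 0, V 4 0), fun n i => V i (if i = 3 then n else n + 1))

theorem measurable_noiseSplit : Measurable noiseSplit := by
  unfold noiseSplit
  fun_prop

/-- The noise processes of the channel in the order of `channelNoise`. -/
def noiseFamily (A B E W U : ℕ → Ω → ℝ) : Fin 5 → ℕ → Ω → ℝ := ![B, W, A, E, U]

namespace IsFlashChannel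

theorem measurable_noiseFamily (h : IsFlashChannel 𝒳 σA σB σE α₁ α₂ P X A B E W U Y) (i : Fin 5)
    (n : ℕ) : Measurable (noiseFamily A B E W U i n) := by
  fin_cases i
  exacts [h.measurable_B n, h.measurable_W n, h.measurable_A n, h.measurable_E n, h.measurable_U n]

theorem map_noiseFamily (h : IsFlashChannel 𝒳 σA σB σE α₁ α₂ P X A B E W U Y) (i : Fin 5)
    (n : ℕ) : P.map (noiseFamily A B E W U i n) = channelNoise σA σB σE α₁ α₂ i := by
  fin_cases i
  exacts [h.law_B n, h.law_W n, h.law_A n, h.law_E n, h.law_U n]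

theorem iIndepFun_noiseFamily (h : IsFlashChannel 𝒳 σA σB σE α₁ α₂ P X A B E W U Y) :
    iIndepFun (fun (p : Fin 5 × ℕ) ω => noiseFamily A B E W U p.1 p.2 ω) P := by
  refine iIndepFun_uncurry' (X := noiseFamily A B E W U) h.measurable_noiseFamily ?_ fun i => ?_
  · have hinj : Function.Injective (![1, 3, 0, 2, 4] : Fin 5 → Fin 6) := by decide
    have := h.indep_processes.precomp hinj
    convert this using 2 with i
    fin_cases i <;> rfl
  · fin_cases i
    exacts [h.indep_B, h.indep_W, h.indep_A, h.indep_E, h.indep_U]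

theorem indepFun_input_noise [IsProbabilityMeasure P]
    (h : IsFlashChannel 𝒳 σA σB σE α₁ α₂ P X A B E W U Y) :
    IndepFun (fun ω n => X n ω) (fun ω i n => noiseFamily A B E W U i n ω) P := by
  obtain ⟨ω₀⟩ := nonempty_of_isProbabilityMeasure P
  have hm : ∀ i, Measurable ((![fun ω n => A n ω, fun ω n => B n ω, fun ω n => E n ω,
      fun ω n => W n ω, fun ω n => U n ω, fun ω n => (X n ω : ℝ)] : Fin 6 → Ω → (ℕ → ℝ)) i) := by
    intro i
    fin_cases i
    exacts [measurable_pi_lambda _ h.measurable_A, measurable_pi_lambda _ h.measurable_B,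
      measurable_pi_lambda _ h.measurable_E, measurable_pi_lambda _ h.measurable_W,
      measurable_pi_lambda _ h.measurable_U,
      measurable_pi_lambda _ fun n => measurable_subtype_coe.comp (h.measurable_X n)]
  have key := h.indep_processes.indepFun_finset {5} (Finset.univ.erase 5) (by simp) hm
  -- the letters of the alphabet are recovered from their real values
  classical
  let q : ℝ → 𝒳 := fun r => if hr : r ∈ 𝒳 then ⟨r, hr⟩ else X 0 ω₀
  have hq : Measurable q :=
    Measurable.dite (s := {r | r ∈ 𝒳}) measurable_id measurable_const 𝒳.measurableSet
  have hqX : ∀ a : 𝒳, q a = a := fun a => by simp [q]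
  let φ : (({5} : Finset (Fin 6)) → ℕ → ℝ) → ℕ → 𝒳 := fun r n => q (r ⟨5, by simp⟩ n)
  have hφ : Measurable φ := measurable_pi_lambda _ fun n => hq.comp (by fun_prop)
  let σ : Fin 5 → Fin 6 := ![1, 3, 0, 2, 4]
  have hσ : ∀ i, σ i ∈ (Finset.univ.erase 5 : Finset (Fin 6)) := by decide
  let ψ : ((Finset.univ.erase 5 : Finset (Fin 6)) → ℕ → ℝ) → Fin 5 → ℕ → ℝ :=
    fun r i n => r ⟨σ i, hσ i⟩ n
  have hψ : Measurable ψ := by fun_prop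
  have := key.comp hφ hψ
  convert this using 1
  · funext ω n
    exact (hqX (X n ω)).symm
  · funext ω i n
    fin_cases i <;> rfl

theorem map_drivingNoise (hα : α₁ < α₂)
    (h : IsFlashChannel 𝒳 σA σB σE α₁ α₂ P X A B E W U Y) :
    P.map (fun ω => (noiseSplit fun i n => noiseFamily A B E W U i n ω).2)
      = Measure.infinitePi fun _ : ℕ => Measure.pi (channelNoise σA σB σE α₁ α₂) := by
  have := isProbabilityMeasure_channelNoise (σA := σA) (σB := σB) (σE := σE) hα
  have hinj : Function.Injective fun q : ℕ × Fin 5 => (q.2, if q.2 = 3 then q.1 else q.1 + 1) := by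
    rintro ⟨n, i⟩ ⟨m, j⟩ hq
    simp only [Prod.mk.injEq] at hq
    obtain ⟨rfl, h2⟩ := hq
    split_ifs at h2 <;> simp_all
  have hi := h.iIndepFun_noiseFamily.precomp hinj
  have hlaw := hi.map_fun_eq_infinitePi_map fun q => h.measurable_noiseFamily _ _
  simp only [h.map_noiseFamily] at hlaw
  have hc := Measure.infinitePi_map_curry
    (μ := fun (_ : ℕ) (i : Fin 5) => channelNoise σA σB σE α₁ α₂ i)
  rw [← hlaw, Measure.map_map (MeasurableEquiv.measurable _)
    (measurable_pi_lambda _ fun q => h.measurable_noiseFamily _ _)] at hc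
  simp only [Measure.infinitePi_eq_pi] at hc
  exact hc

theorem measurable_noise (h : IsFlashChannel 𝒳 σA σB σE α₁ α₂ P X A B E W U Y) :
    Measurable fun ω => (fun i n => noiseFamily A B E W U i n ω : Fin 5 → ℕ → ℝ) :=
  measurable_pi_lambda _ fun i => measurable_pi_lambda _ fun n => h.measurable_noiseFamily i n

theorem measurable_output_zero (h : IsFlashChannel 𝒳 σA σB σE α₁ α₂ P X A B E W U Y) :
    Measurable (Y 0) := by
  have : Y 0 = fun ω => (X 0 ω : ℝ) + W 0 ω + U 0 ω := funext h.output_zero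
  rw [this]
  exact ((measurable_subtype_coe.comp (h.measurable_X 0)).add (h.measurable_W 0)).add
    (h.measurable_U 0)

/-- The input sequence and the initial output are independent of the noise driving the later
outputs. -/
theorem indepFun_initial_drivingNoise [IsProbabilityMeasure P]
    (h : IsFlashChannel 𝒳 σA σB σE α₁ α₂ P X A B E W U Y) :
    IndepFun (fun ω => ((fun n => X n ω), Y 0 ω))
      (fun ω => (noiseSplit fun i n => noiseFamily A B E W U i n ω).2) P := by
  have hX : Measurable fun ω n => X n ω := measurable_pi_lambda _ h.measurable_X
  have hS := measurable_noiseSplit.comp h.measurable_noise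
  have h1 : IndepFun (fun ω n => X n ω)
      (fun ω => noiseSplit fun i n => noiseFamily A B E W U i n ω) P :=
    h.indepFun_input_noise.comp measurable_id measurable_noiseSplit
  have h2 : IndepFun (fun ω => (noiseSplit fun i n => noiseFamily A B E W U i n ω).1)
      (fun ω => (noiseSplit fun i n => noiseFamily A B E W U i n ω).2) P := by
    have hd : Disjoint ({(1, 0), (4, 0)} : Set (Fin 5 × ℕ)) {(1, 0), (4, 0)}ᶜ :=
      disjoint_compl_right
    have key := iIndepFun_indepFun_of_disjoint h.iIndepFun_noiseFamily
      (fun p => h.measurable_noiseFamily p.1 p.2) hd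
    have hmem : ∀ (n : ℕ) (i : Fin 5), (i, if i = 3 then n else n + 1)
        ∈ ({(1, 0), (4, 0)} : Set (Fin 5 × ℕ))ᶜ := by
      intro n i
      fin_cases i <;> simp
    let φ : (({(1, 0), (4, 0)} : Set (Fin 5 × ℕ)) → ℝ) → ℝ × ℝ :=
      fun r => (r ⟨(1, 0), by simp⟩, r ⟨(4, 0), by simp⟩)
    let ψ : ((({(1, 0), (4, 0)} : Set (Fin 5 × ℕ))ᶜ : Set (Fin 5 × ℕ)) → ℝ) → ℕ → Fin 5 → ℝ :=
      fun r n i => r ⟨_, hmem n i⟩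
    exact key.comp (φ := φ) (ψ := ψ) (by fun_prop) (by fun_prop)
  have h3 := indepFun_prodMk_of_indepFun hX (measurable_fst.comp hS) (measurable_snd.comp hS) h1 h2
  let φ : (ℕ → 𝒳) × (ℝ × ℝ) → (ℕ → 𝒳) × ℝ := fun p => (p.1, (p.1 0 : ℝ) + p.2.1 + p.2.2)
  have hφ : Measurable φ := by fun_prop
  have h4 := h3.comp hφ measurable_id
  have e : (fun ω => ((fun n => X n ω), Y 0 ω))
      = φ ∘ fun ω => ((fun n => X n ω),
        (noiseSplit fun i n => noiseFamily A B E W U i n ω).1) := by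
    funext ω
    exact Prod.ext rfl (h.output_zero ω)
  rw [e]
  exact h4

theorem output_eq_outputPath (h : IsFlashChannel 𝒳 σA σB σE α₁ α₂ P X A B E W U Y) (ω : Ω) :
    (fun n => Y n ω) = outputPath (fun n => X n ω) (Y 0 ω)
      (noiseSplit fun i n => noiseFamily A B E W U i n ω).2 := by
  funext n
  induction n with
  | zero => rfl
  | succ n ih =>
    rw [outputPath, ← ih, h.output_succ n ω]
    simp [channelStep, noiseSplit, noiseFamily]

theorem jointProcessLaw_eq (hα : α₁ < α₂) [IsProbabilityMeasure P]
    (h : IsFlashChannel 𝒳 σA σB σE α₁ α₂ P X A B E W U Y) :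
    jointProcessLaw P X Y = ((P.map fun ω => ((fun n => X n ω), Y 0 ω)).prod
      (Measure.infinitePi fun _ : ℕ => Measure.pi (channelNoise σA σB σE α₁ α₂))).map ioPath := by
  have hQ : Measurable fun ω => ((fun n => X n ω), Y 0 ω) :=
    (measurable_pi_lambda _ h.measurable_X).prodMk h.measurable_output_zero
  have hN : Measurable fun ω => (noiseSplit fun i n => noiseFamily A B E W U i n ω).2 :=
    measurable_snd.comp (measurable_noiseSplit.comp h.measurable_noise)
  rw [← h.map_drivingNoise hα,
    ← (indepFun_iff_map_prod_eq_prod_map_map hQ.aemeasurable hN.aemeasurable).1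
      h.indepFun_initial_drivingNoise,
    Measure.map_map measurable_ioPath (hQ.prodMk hN), jointProcessLaw]
  congr 1
  funext ω
  exact Prod.ext rfl (h.output_eq_outputPath ω)

end IsFlashChannel

/-- A bound for the second moment of the initial output. -/
noncomputable def initialBound (𝒳 : Finset ℝ) (μ : Fin 5 → Measure ℝ) : ℝ :=
  3 * (∑ a ∈ 𝒳, a ^ 2 + ∫ w, w ^ 2 ∂(μ 1) + ∫ u, u ^ 2 ∂(μ 4))

namespace IsFlashChannel

theorem integrable_output_zero_sq (hα : α₁ < α₂) [IsProbabilityMeasure P]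
    (h : IsFlashChannel 𝒳 σA σB σE α₁ α₂ P X A B E W U Y) :
    Integrable (fun ω => (Y 0 ω) ^ 2) P ∧
      ∫ ω, (Y 0 ω) ^ 2 ∂P ≤ initialBound 𝒳 (channelNoise σA σB σE α₁ α₂) := by
  have hL := (isChannelNoise_channelNoise (σA := σA) (σB := σB) (σE := σE) hα).memLp
  have hnoise : ∀ i, Integrable (fun ω => (noiseFamily A B E W U i 0 ω) ^ 2) P ∧
      ∫ ω, (noiseFamily A B E W U i 0 ω) ^ 2 ∂P
        = ∫ b, b ^ 2 ∂(channelNoise σA σB σE α₁ α₂ i) := by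
    intro i
    have hm := h.measurable_noiseFamily i 0
    have hs : Integrable (fun b : ℝ => b ^ 2) (P.map (noiseFamily A B E W U i 0)) := by
      rw [h.map_noiseFamily]; exact (hL i).integrable_sq
    refine ⟨hs.comp_measurable hm, ?_⟩
    rw [← h.map_noiseFamily i 0, integral_map hm.aemeasurable hs.aestronglyMeasurable]
  obtain ⟨iW, eW⟩ := hnoise 1
  obtain ⟨iU, eU⟩ := hnoise 4
  have hbd : ∀ ω, (Y 0 ω) ^ 2 ≤ 3 * (∑ a ∈ 𝒳, a ^ 2 + (noiseFamily A B E W U 1 0 ω) ^ 2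
      + (noiseFamily A B E W U 4 0 ω) ^ 2) := by
    intro ω
    have hX : (X 0 ω : ℝ) ^ 2 ≤ ∑ a ∈ 𝒳, a ^ 2 :=
      Finset.single_le_sum (f := fun a : ℝ => a ^ 2) (fun a _ => sq_nonneg a) (X 0 ω).2
    rw [h.output_zero ω]
    change ((X 0 ω : ℝ) + W 0 ω + U 0 ω) ^ 2 ≤ 3 * (∑ a ∈ 𝒳, a ^ 2 + (W 0 ω) ^ 2 + (U 0 ω) ^ 2)
    nlinarith [sq_nonneg ((X 0 ω : ℝ) - W 0 ω), sq_nonneg ((X 0 ω : ℝ) - U 0 ω),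
      sq_nonneg (W 0 ω - U 0 ω)]
  have iS : Integrable (fun ω => 3 * (∑ a ∈ 𝒳, a ^ 2 + (noiseFamily A B E W U 1 0 ω) ^ 2
      + (noiseFamily A B E W U 4 0 ω) ^ 2)) P :=
    (((integrable_const _).add iW).add iU).const_mul 3
  have iY : Integrable (fun ω => (Y 0 ω) ^ 2) P := by
    refine iS.mono' (h.measurable_output_zero.pow_const 2).aestronglyMeasurable
      (ae_of_all _ fun ω => ?_)
    rw [Real.norm_of_nonneg (sq_nonneg _)]
    exact hbd ω
  refine ⟨iY, (integral_mono iY iS hbd).trans (le_of_eq ?_)⟩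
  have iC : Integrable (fun ω => ∑ a ∈ 𝒳, a ^ 2 + (noiseFamily A B E W U 1 0 ω) ^ 2) P :=
    (integrable_const _).add iW
  rw [integral_const_mul, integral_add iC iU, integral_add (integrable_const _) iW, eW, eU]
  simp [initialBound]

end IsFlashChannel

theorem leftShift_iterate_zero {β : Type*} (k : ℕ) (x : ℕ → β) : leftShift^[k] x 0 = x k := by
  induction k generalizing x with
  | zero => rfl
  | succ k ih => rw [Function.iterate_succ_apply, ih]; rfl

theorem leftShiftPair_iterate {β γ : Type*} (k : ℕ) (z : (ℕ → β) × (ℕ → γ)) :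
    leftShiftPair^[k] z = (leftShift^[k] z.1, leftShift^[k] z.2) := by
  induction k generalizing z with
  | zero => rfl
  | succ k ih => rw [Function.iterate_succ_apply, ih]; rfl

end

/-! ### Asymptotic mean stationarity, ergodicity and the rate of convergence -/

theorem mainTheorem3 (𝒳 : Finset ℝ) (σA σB σE : ℝ≥0) (hσB_pos : 0 < σB) (hσB_lt : σB < 1)
    (α₁ α₂ : ℝ) (hα : α₁ < α₂) :
    ∃ C : ℝ, ∀ (Ω : Type*) [MeasurableSpace Ω] (P : Measure Ω) [IsProbabilityMeasure P]
      (X : ℕ → Ω → 𝒳) (A B E W U Y : ℕ → Ω → ℝ),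
      IsFlashChannel 𝒳 σA σB σE α₁ α₂ P X A B E W U Y →
      Ergodic leftShift (processLaw P X) →
        -- asymptotic mean stationarity
        IsAsymptoticallyMeanStationary leftShift (processLaw P Y) ∧
        IsAsymptoticallyMeanStationary leftShiftPair (jointProcessLaw P X Y) ∧
        -- ergodicity: every shift invariant event has probability zero or one
        PreErgodic leftShift (processLaw P Y) ∧
        PreErgodic leftShiftPair (jointProcessLaw P X Y) ∧
        -- exponential convergence of the one-dimensional marginals to those of the stationary mean
        (∀ ν : Measure (ℕ → ℝ), IsStationaryMean leftShift (processLaw P Y) ν →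
          ∀ (k : ℕ) (D : Set ℝ), MeasurableSet D →
            |P.real {ω | Y k ω ∈ D} - ν.real {y | y 0 ∈ D}| ≤ C * (σB : ℝ) ^ (2 * k)) ∧
        (∀ ν : Measure ((ℕ → 𝒳) × (ℕ → ℝ)),
          IsStationaryMean leftShiftPair (jointProcessLaw P X Y) ν →
          ∀ (k : ℕ) (D : Set (𝒳 × ℝ)), MeasurableSet D →
            |P.real {ω | (X k ω, Y k ω) ∈ D} - ν.real {z | (z.1 0, z.2 0) ∈ D}|
              ≤ C * (σB : ℝ) ^ (2 * k)) := by
  set μ := channelNoise σA σB σE α₁ α₂ with hμ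
  have hprob : ∀ i, IsProbabilityMeasure (μ i) := isProbabilityMeasure_channelNoise hα
  have hnoise : IsChannelNoise μ ((σB : ℝ) ^ 2) := isChannelNoise_channelNoise hα
  have hv0 : 0 < (σB : ℝ) ^ 2 := by positivity
  have hv1 : (σB : ℝ) ^ 2 < 1 := pow_lt_one₀ σB.2 (by exact_mod_cast hσB_lt) two_ne_zero
  set C := rateConst 𝒳 μ ((σB : ℝ) ^ 2) (initialBound 𝒳 μ) with hC
  refine ⟨C, fun Ω _ P _ X A B E W U Y h hX => ?_⟩
  have hXm : Measurable fun ω n => X n ω := measurable_pi_lambda _ h.measurable_X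
  have hQm : Measurable fun ω => ((fun n => X n ω), Y 0 ω) := hXm.prodMk h.measurable_output_zero
  set Q := P.map fun ω => ((fun n => X n ω), Y 0 ω) with hQ
  have hQprob : IsProbabilityMeasure Q := Measure.isProbabilityMeasure_map hQm.aemeasurable
  have hQfst : Q.map Prod.fst = processLaw P X := Measure.map_map measurable_fst hQm
  have hsq : Measurable fun z : (ℕ → 𝒳) × ℝ => z.2 ^ 2 := by fun_prop
  obtain ⟨hY1, hY2⟩ := h.integrable_output_zero_sq hα
  have hint : Integrable (fun z => z.2 ^ 2) Q :=
    (integrable_map_measure hsq.aestronglyMeasurable hQm.aemeasurable).2 hY1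
  have hV : ∫ z, z.2 ^ 2 ∂Q ≤ initialBound 𝒳 μ := by
    rw [hQ, integral_map hQm.aemeasurable hsq.aestronglyMeasurable]
    exact hY2
  have hYm : Measurable fun ω n => Y n ω := by
    have e : (fun ω n => Y n ω) = fun ω => (ioPath (((fun n => X n ω), Y 0 ω),
        (noiseSplit fun i n => noiseFamily A B E W U i n ω).2)).2 :=
      funext fun ω => h.output_eq_outputPath ω
    rw [e]
    exact measurable_snd.comp (measurable_ioPath.comp
      (hQm.prodMk (measurable_snd.comp (measurable_noiseSplit.comp h.measurable_noise))))
  set M := jointProcessLaw P X Y with hM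
  have hXYm : Measurable fun ω => ((fun n => X n ω), (fun n => Y n ω)) := hXm.prodMk hYm
  have hMprob : IsProbabilityMeasure M := Measure.isProbabilityMeasure_map hXYm.aemeasurable
  have hMsnd : processLaw P Y = M.map Prod.snd := (Measure.map_map measurable_snd hXYm).symm
  have hYprob : IsProbabilityMeasure (processLaw P Y) :=
    Measure.isProbabilityMeasure_map hYm.aemeasurable
  have hbound : ∀ S, MeasurableSet S → ∀ i j, i ≤ j →
      |M.real (leftShiftPair^[i] ⁻¹' S) - M.real (leftShiftPair^[j] ⁻¹' S)|
        ≤ C * ((σB : ℝ) ^ 2) ^ i := by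
    intro S hS i j hij
    rw [hM, h.jointProcessLaw_eq hα]
    exact abs_measureReal_preimage_iterate_sub_le hnoise hv0 hv1
      (by rw [hQfst]; exact hX.toMeasurePreserving) hint hV hS hij
  have hproj : ∀ S : Set (ℕ → ℝ), MeasurableSet S → ∀ i,
      (processLaw P Y).real (leftShift^[i] ⁻¹' S)
        = M.real (leftShiftPair^[i] ⁻¹' (Prod.snd ⁻¹' S)) := by
    intro S hS i
    rw [hMsnd, map_measureReal_apply measurable_snd (measurable_leftShift.iterate i hS)]
    congr 1
    ext z
    simp [leftShiftPair_iterate]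
  have hboundY : ∀ S, MeasurableSet S → ∀ i j, i ≤ j →
      |(processLaw P Y).real (leftShift^[i] ⁻¹' S) - (processLaw P Y).real (leftShift^[j] ⁻¹' S)|
        ≤ C * ((σB : ℝ) ^ 2) ^ i := by
    intro S hS i j hij
    rw [hproj S hS, hproj S hS]
    exact hbound _ (measurable_snd hS) i j hij
  have hlim : Tendsto (fun i : ℕ => C * ((σB : ℝ) ^ 2) ^ i) atTop (𝓝 0) := by
    simpa using (tendsto_pow_atTop_nhds_zero_of_lt_one hv0.le hv1).const_mul C
  have hergM : PreErgodic leftShiftPair M := by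
    rw [hM, h.jointProcessLaw_eq hα]
    exact preErgodic_map_ioPath hnoise hv0 hv1 (by rw [hQfst]; exact hX)
  refine ⟨isAsymptoticallyMeanStationary_of_abs_sub_le measurable_leftShift hlim hboundY,
    isAsymptoticallyMeanStationary_of_abs_sub_le measurable_leftShiftPair hlim hbound, ?_, hergM, ?_, ?_⟩
  · have hmp : MeasurePreserving Prod.snd M (processLaw P Y) := ⟨measurable_snd, hMsnd.symm⟩
    refine ⟨fun S hS hinv => ?_⟩
    have := hergM.aeconst_set (measurable_snd hS)
      (by rw [← Set.preimage_comp]; exact congrArg (Prod.snd ⁻¹' ·) hinv)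
    rw [eventuallyConst_set'] at this ⊢
    refine this.imp (fun h0 => ?_) fun h1 => ?_
    · rw [ae_eq_empty] at h0 ⊢
      rwa [hmp.measure_preimage hS.nullMeasurableSet] at h0
    · rw [ae_eq_univ, ← Set.preimage_compl, hmp.measure_preimage hS.compl.nullMeasurableSet] at h1
      rwa [ae_eq_univ]
  · intro ν hν k D hD
    have hS : MeasurableSet {y : ℕ → ℝ | y 0 ∈ D} := measurable_pi_apply 0 hD
    have := abs_measureReal_sub_stationaryMean_le hν hlim hS (hboundY _ hS) k
    rw [pow_mul]
    convert this using 3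
    rw [processLaw, map_measureReal_apply hYm (measurable_leftShift.iterate k hS)]
    congr 1
    ext ω
    simp [leftShift_iterate_zero]
  · intro ν hν k D hD
    have hS : MeasurableSet {z : (ℕ → 𝒳) × (ℕ → ℝ) | (z.1 0, z.2 0) ∈ D} :=
      hD.preimage (by fun_prop)
    have := abs_measureReal_sub_stationaryMean_le hν hlim hS (hbound _ hS) k
    rw [pow_mul]
    convert this using 3
    rw [hM, jointProcessLaw, map_measureReal_apply hXYm (measurable_leftShiftPair.iterate k hS)]
    congr 1
    ext ω
    simp [leftShiftPair_iterate, leftShift_iterate_zero]
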